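/- Let $\mathbb{F}$ be an algebraically closed field, $G$ an abelian group, $\mathcal{R}=\bigoplus_{g\in G}\mathcal{R}_g$ a unital associative $G$-graded $\mathbb{F}$-algebra, and $\mathcal{W}=\bigoplus_{g\in G}\mathcal{W}_g$ a finite-dimensional $G$-graded simple left $\mathcal{R}$-module (that is, $\mathcal W\neq 0$ and its only graded submodules are $0$ and $\mathcal W$). Let $C(\mathcal{W})=\mathrm{End}_{\mathcal{R}}(\mathcal{W})$, with endomorphisms written on the right, graded by $C(\mathcal{W})_g=\{c : \mathcal{W}_h c\subseteq\mathcal{W}_{gh}\ \forall h\in G\}$. Assume that $\mathrm{char}\,\mathbb{F}$ does not divide $\dim C(\mathcal{W})$. For a subgroup $K\le G$, the algebra $\mathcal R$ is regarded as $G/K$-graded by $\mathcal{R}_{gK}=\bigoplus_{k\in K}\mathcal{R}_{gk}$, and similarly for other $G$-graded spaces. Let $\mathcal{V}$ be a simple (ungraded) submodule of $\mathcal{W}$, let $\varrho_{\mathcal{V}}:\mathcal{R}\to\mathrm{End}_{\mathbb{F}}(\mathcal{V})$ be the associated representation, and let $Z=\{g\in G : \mathcal Z\cap C(\mathcal W)_g\ne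 0\}$ be the support of the center $\mathcal Z$ of $C(\mathcal{W})$; $Z$ is a subgroup of $G$. Then: (i) There is a unique $G/Z$-grading on the algebra $\mathrm{End}_{\mathbb{F}}(\mathcal{V})$ that makes $\varrho_{\mathcal{V}}$ a homomorphism of $G/Z$-graded algebras. (ii) With this grading, the class $[\mathrm{End}_{\mathbb{F}}(\mathcal{V})]$ is the graded Brauer invariant of $\mathcal{W}$: for any primitive idempotent $\varepsilon$ of $\mathcal{Z}$ (and such idempotents exist), one has $[C(\mathcal{W})\varepsilon]=[\mathrm{End}_{\mathbb{F}}(\mathcal{V})]$ in the $G/Z$-graded Brauer group of $\mathbb{F}$, where $(C(\mathcal{W})\varepsilon)_{gZ}=C(\mathcal{W})_{gZ}\,\varepsilon$. Here the graded Brauer group consists of the classes of finite-dimensional central simple $G/Z$-graded algebras, and $[\mathcal{A}]=[\mathcal{B}]$ means that $\mathcal{A}\otimes\mathrm{End}_{\mathbb{F}}(\mathcal{V}_1)\simeq\mathcal{B}\otimes\mathrm{End}_{\mathbb{F}}(\mathcal{V}_2)$ as $G/Z$-graded algebras for some nonzero finite-dimensional $G/Z$-graded vector spaces $\mathcal{V}_1,\mathcal{V}_2$.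 (iii) Let $H$ be a subgroup of $G$ contained in the support $\{g\in G: C(\mathcal{W})_g\neq 0\}$ of $C(\mathcal{W})$, and maximal among such subgroups with the property that $\mathcal{F}:=\bigoplus_{h\in H}C(\mathcal{W})_h$ is commutative. Then $\mathcal{F}$ is a maximal graded subfield of $C(\mathcal{W})$ (maximal among the commutative graded subalgebras in which every nonzero homogeneous element is invertible), isomorphic to the group algebra $\mathbb{F}H$ as a $G$-graded algebra, and $\mathcal{V}$ admits a grading by $G/H$ that makes it a $G/H$-graded $\mathcal{R}$-module and a central image of $(\mathcal{W},\mathcal{F})$. The latter means that there exist a homomorphism of unital $\mathbb F$-algebras $\rho:\mathcal{F}\to\mathbb{F}$ and a surjective homomorphism of $\mathcal{R}$-modules $\gamma:\mathcal{W}\to\mathcal{V}$ such that $\gamma(wc)=\rho(c)\gamma(w)$ for all $w\in\mathcal{W}$, $c\in\mathcal{F}$, and $\gamma(\mathcal{W}_g)\subseteq\mathcal{V}_{gH}$ for all $g\in G$. -/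

import Mathlib

/-! The abelian grading group `G` is written additively. -/

open scoped TensorProduct

namespace GrMod

universe u

section Gradings

variable {F : Type u} [Field F]

open Classical in
/-- A `G`-grading on a vector space: `V = ⨁ g, 𝒱 g`. -/
def IsGrading {G V : Type*} [AddCommGroup V] [Module F V]
    (𝒱 : G → Submodule F V) : Prop :=
  DirectSum.IsInternal 𝒱

/-- A `G`-grading on a unital associative algebra. -/
structure IsGradedAlgebra {G A : Type*} [AddCommGroup G] [Ring A] [Algebra F A]
    (𝒜 : G → Submodule F A) : Prop where
  grading : IsGrading 𝒜
  graded_mul : SetLike.GradedMonoid 𝒜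

/-- A `G`-grading on a left `R`-module that is compatible with the grading `ℛ` of `R`. -/
structure IsGradedModule {G R V : Type*} [AddCommGroup G] [Ring R] [Algebra F R]
    [AddCommGroup V] [Module F V] [Module R V]
    (ℛ : G → Submodule F R) (𝒱 : G → Submodule F V) : Prop where
  grading : IsGrading 𝒱
  graded_smul : SetLike.GradedSMul ℛ 𝒱

/-- The support of a family of homogeneous components. -/
def support {G V : Type*} [AddCommGroup V] [Module F V] (𝒱 : G → Submodule F V) : Set G :=
  {g | 𝒱 g ≠ ⊥}

/-- The grading by `K` induced from a grading by `G` by means of `α : G →+ K`. -/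
def induced {G K V : Type*} [AddCommGroup G] [AddCommGroup K] [AddCommGroup V] [Module F V]
    (α : G →+ K) (𝒱 : G → Submodule F V) (k : K) : Submodule F V :=
  ⨆ g : G, ⨆ _ : α g = k, 𝒱 g

/-- `N` is a graded subspace: `N = ⨁ g, N ∩ V_g`. -/
def IsGradedSubspace {G V : Type*} [AddCommGroup V] [Module F V]
    (𝒱 : G → Submodule F V) (N : Submodule F V) : Prop :=
  N = ⨆ g, N ⊓ 𝒱 g

/-- `W` is nonzero, and its only graded `R`-submodules are `0` and `W`. -/
def IsGradedSimple {G : Type*} (R : Type*) {W : Type*} [Ring R] [Algebra F R]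
    [AddCommGroup W] [Module F W] [Module R W] [IsScalarTower F R W]
    (𝒲 : G → Submodule F W) : Prop :=
  Nontrivial W ∧ ∀ N : Submodule R W,
    IsGradedSubspace 𝒲 (N.restrictScalars F) → N = ⊥ ∨ N = ⊤

/-- The component of degree `g` of `End_F(V)`: the maps taking `V_h` into `V_{g+h}` for all `h`. -/
def endGrading {G V : Type*} [AddCommGroup G] [AddCommGroup V] [Module F V]
    (𝒱 : G → Submodule F V) (g : G) : Submodule F (Module.End F V) where
  carrier := {f | ∀ h, ∀ v ∈ 𝒱 h, f v ∈ 𝒱 (g + h)}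
  add_mem' ha hb h v hv := (𝒱 (g + h)).add_mem (ha h v hv) (hb h v hv)
  zero_mem' h _ _ := (𝒱 (g + h)).zero_mem
  smul_mem' c _ ha h v hv := (𝒱 (g + h)).smul_mem c (ha h v hv)

/-- The natural grading on the (untwisted) tensor product of graded algebras:
`(A ⊗ B)_k` is the sum of all `A_i ⊗ B_j` with `i + j = k`. -/
def tensorGrading {G A B : Type*} [AddCommGroup G] [Ring A] [Algebra F A] [Ring B] [Algebra F B]
    (𝒜 : G → Submodule F A) (ℬ : G → Submodule F B) (k : G) : Submodule F (A ⊗[F] B) :=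
  ⨆ i : G, ⨆ j : G, ⨆ _ : i + j = k, Submodule.map₂ (TensorProduct.mk F A B) (𝒜 i) (ℬ j)

/-- `A` with the grading `𝒜` is a finite-dimensional, central, simple, graded algebra, so that
it has a class in the graded Brauer group. -/
structure IsGradedCSA {G A : Type*} [AddCommGroup G] [Ring A] [Algebra F A]
    (𝒜 : G → Submodule F A) : Prop where
  gradedAlgebra : IsGradedAlgebra 𝒜
  finiteDimensional : FiniteDimensional F A
  central : Algebra.IsCentral F A
  simple : IsSimpleRing A

/-- Equality `[A] = [B]` in the `G`-graded Brauer group of `F`: both algebras are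
finite-dimensional central simple `G`-graded algebras, and `A ⊗ End(V₁) ≃ B ⊗ End(V₂)` as graded
algebras for some nonzero finite-dimensional graded vector spaces `V₁`, `V₂`. -/
def BrauerEq {G A B : Type*} [AddCommGroup G] [Ring A] [Algebra F A] [Ring B] [Algebra F B]
    (𝒜 : G → Submodule F A) (ℬ : G → Submodule F B) : Prop :=
  IsGradedCSA 𝒜 ∧ IsGradedCSA ℬ ∧
  ∃ (V₁ V₂ : Type u) (_ : AddCommGroup V₁) (_ : Module F V₁) (_ : AddCommGroup V₂)
    (_ : Module F V₂) (𝒱₁ : G → Submodule F V₁) (𝒱₂ : G → Submodule F V₂),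
    Nontrivial V₁ ∧ Nontrivial V₂ ∧ FiniteDimensional F V₁ ∧ FiniteDimensional F V₂ ∧
    IsGrading 𝒱₁ ∧ IsGrading 𝒱₂ ∧
    ∃ e : (A ⊗[F] Module.End F V₁) ≃ₐ[F] (B ⊗[F] Module.End F V₂),
      ∀ k : G, (tensorGrading 𝒜 (endGrading 𝒱₁) k).map e.toLinearMap
        = tensorGrading ℬ (endGrading 𝒱₂) k

end Gradings

section Idempotents

/-- A nonzero idempotent that is not the sum of two nonzero orthogonal idempotents. -/
structure IsPrimitiveIdempotent {A : Type*} [Ring A] (e : A) : Prop where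
  idem : IsIdempotentElem e
  ne_zero : e ≠ 0
  indecomposable : ∀ a b : A, IsIdempotentElem a → IsIdempotentElem b →
    a * b = 0 → b * a = 0 → a + b = e → a = 0 ∨ b = 0

theorem IsPrimitiveIdempotent.coe_idem {F A : Type*} [Field F] [Ring A] [Algebra F A]
    {S : Subalgebra F A} {e : S} (he : IsPrimitiveIdempotent e) : IsIdempotentElem (e : A) :=
  congrArg Subtype.val he.idem

variable {F A : Type*} [Field F] [Ring A] [Algebra F A] {e : A}

instance cornerSMul (he : IsIdempotentElem e) : SMul F he.Corner where
  smul c x := ⟨c • x.1, by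
    obtain ⟨r, hr⟩ := x.2
    exact ⟨c • r, by simp only [mul_smul_comm, smul_mul_assoc]; exact congrArg (c • ·) hr⟩⟩

/-- The inclusion of `eAe` into `A`, as an additive map. -/
def cornerIncl (he : IsIdempotentElem e) : he.Corner →+ A where
  toFun x := x.1
  map_zero' := rfl
  map_add' _ _ := rfl

theorem cornerIncl_injective (he : IsIdempotentElem e) : Function.Injective (cornerIncl he) :=
  fun _ _ h => Subtype.ext h

instance cornerModule (he : IsIdempotentElem e) : Module F he.Corner :=
  Function.Injective.module F (cornerIncl he) (cornerIncl_injective he) fun _ _ => rfl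

/-- The corner `eAe`, a ring with identity element `e`, is an `F`-algebra if `A` is. -/
instance cornerAlgebra (he : IsIdempotentElem e) : Algebra F he.Corner :=
  Algebra.ofModule
    (fun c x y => Subtype.ext (smul_mul_assoc c x.1 y.1))
    (fun c x y => Subtype.ext (mul_smul_comm c x.1 y.1))

/-- For `e` idempotent, the components `(eAe)_k = {x ∈ eAe | x ∈ A_k e}`.  For `e` central one has
`eAe = Ae`, and these are the subspaces `A_k e` of `Ae`. -/
def cornerGrading {K : Type*} (𝒜 : K → Submodule F A) (he : IsIdempotentElem e) (k : K) :
    Submodule F he.Corner where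
  carrier := {x | ∃ a ∈ 𝒜 k, x.1 = a * e}
  add_mem' := by
    rintro x y ⟨a, ha, hx⟩ ⟨b, hb, hy⟩
    exact ⟨a + b, (𝒜 k).add_mem ha hb, (congrArg₂ (· + ·) hx hy).trans (add_mul a b e).symm⟩
  zero_mem' := ⟨0, (𝒜 k).zero_mem, (zero_mul e).symm⟩
  smul_mem' := by
    rintro c x ⟨a, ha, hx⟩
    exact ⟨c • a, (𝒜 k).smul_mem c ha, (congrArg (c • ·) hx).trans (smul_mul_assoc c a e).symm⟩

end Idempotents

section Modules

variable {F : Type u} [Field F]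

/-- The centralizer `C(W)`: the `R`-endomorphisms of the left module `W`, written on the right,
so that the product of `c` and `d` is "first `c`, then `d`". -/
abbrev Centralizer (R W : Type*) [Ring R] [AddCommGroup W] [Module R W] : Type _ :=
  (Module.End R W)ᵐᵒᵖ

variable {G : Type*} [AddCommGroup G] {R : Type*} [Ring R] [Algebra F R]
  {W : Type*} [AddCommGroup W] [Module F W] [Module R W] [IsScalarTower F R W]

/-- The component `C(W)_g`: the elements of `C(W)` taking `W_h` into `W_{g+h}` for all `h`. -/
def centGrading (R : Type*) [Ring R] [Algebra F R] [Module R W] [IsScalarTower F R W]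
    (𝒲 : G → Submodule F W) (g : G) : Submodule F (Centralizer R W) where
  carrier := {c | ∀ h, ∀ w ∈ 𝒲 h, c.unop w ∈ 𝒲 (g + h)}
  add_mem' ha hb h v hv := (𝒲 (g + h)).add_mem (ha h v hv) (hb h v hv)
  zero_mem' h _ _ := (𝒲 (g + h)).zero_mem
  smul_mem' c _ ha h v hv := (𝒲 (g + h)).smul_mem c (ha h v hv)

/-- The support of the center of `C(W)`. -/
def centerSupport (R : Type*) [Ring R] [Algebra F R] [Module R W] [IsScalarTower F R W]
    (𝒲 : G → Submodule F W) : Set G :=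
  support fun g => Subalgebra.toSubmodule (Subalgebra.center F (Centralizer R W)) ⊓
    centGrading R 𝒲 g

/-- The class of the `G/Z`-graded algebra `(E, ℰ)` in the `G/Z`-graded Brauer group is the graded
Brauer invariant of `W`, that is, the class of `C(W)ε`, where `ε` is any primitive idempotent of
the center of `C(W)`.  Here `Z` is meant to be the support of the center of `C(W)`. -/
def IsBrauerInvariant (R : Type*) [Ring R] [Algebra F R] [Module R W] [IsScalarTower F R W]
    (𝒲 : G → Submodule F W) (Z : AddSubgroup G) {E : Type*} [Ring E] [Algebra F E]
    (ℰ : G ⧸ Z → Submodule F E) : Prop :=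
  (∃ ε : Subalgebra.center F (Centralizer R W), IsPrimitiveIdempotent ε) ∧
  ∀ (ε : Subalgebra.center F (Centralizer R W)) (hε : IsPrimitiveIdempotent ε),
    BrauerEq
      (cornerGrading (induced (QuotientAddGroup.mk' Z) (centGrading R 𝒲)) hε.coe_idem) ℰ

/-- The subalgebra `⨁ h ∈ H, C(W)_h` of `C(W)`. -/
def centPart (R : Type*) [Ring R] [Algebra F R] [Module R W] [IsScalarTower F R W]
    (𝒲 : G → Submodule F W) (H : AddSubgroup G) : Subalgebra F (Centralizer R W) :=
  Submodule.toSubalgebra (⨆ h : H, centGrading R 𝒲 h)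
    (Submodule.mem_iSup_of_mem (0 : H) fun h w hw => by simpa using hw)
    (by
      intro x y hx hy
      induction hx using Submodule.iSup_induction' with
      | zero => rw [zero_mul]; exact Submodule.zero_mem _
      | add a b _ _ ha hb => rw [add_mul]; exact Submodule.add_mem _ ha hb
      | mem i a ha =>
        induction hy using Submodule.iSup_induction' with
        | zero => rw [mul_zero]; exact Submodule.zero_mem _
        | add c d _ _ hc hd => rw [mul_add]; exact Submodule.add_mem _ hc hd
        | mem j b hb =>
          refine Submodule.mem_iSup_of_mem (i + j) fun h w hw => ?_
          have := hb _ _ (ha h w hw)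
          rw [← add_assoc, add_comm (j : G)] at this
          exact this)

/-- `K` is a graded subfield of the graded algebra `(A, 𝒜)`: a graded subalgebra that is
commutative and in which every nonzero homogeneous element is invertible. -/
structure IsGradedSubfield {A : Type*} [Ring A] [Algebra F A]
    (𝒜 : G → Submodule F A) (K : Subalgebra F A) : Prop where
  graded : IsGradedSubspace 𝒜 (Subalgebra.toSubmodule K)
  comm : ∀ a ∈ K, ∀ b ∈ K, a * b = b * a
  inv : ∀ g, ∀ a ∈ K, a ∈ 𝒜 g → a ≠ 0 → ∃ b ∈ K, a * b = 1

/-- `(W, 𝓕)` is an object of the groupoid `𝔑(π)`, where `π : G → G/H` is the natural map: `W` is a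
`G`-graded simple module, and `𝓕` is a maximal graded subfield of `C(W)` that is isomorphic to the
group algebra of `H` as a `G`-graded algebra. -/
structure IsPair (ℛ : G → Submodule F R) (𝒲 : G → Submodule F W) (H : AddSubgroup G)
    (𝓕 : Subalgebra F (Centralizer R W)) : Prop where
  gradedModule : IsGradedModule ℛ 𝒲
  gradedSimple : IsGradedSimple R 𝒲
  maximal : Maximal (IsGradedSubfield (centGrading R 𝒲)) 𝓕
  groupAlgebra : ∃ e : AddMonoidAlgebra F H ≃ₐ[F] 𝓕,
    ∀ h : H, (e (AddMonoidAlgebra.single h 1) : Centralizer R W) ∈ centGrading R 𝒲 h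

/-- The `G/H`-graded module `(V, 𝒱)` is a central image of the object `(W, 𝓕)` of `𝔑(π)`: for some
homomorphism of unital algebras `ρ : 𝓕 → F` there is a `ρ`-specialization `γ : W → V`. -/
def IsCentralImage (ℛ : G → Submodule F R) (𝒲 : G → Submodule F W) (H : AddSubgroup G)
    (𝓕 : Subalgebra F (Centralizer R W)) {V : Type*} [AddCommGroup V] [Module F V] [Module R V]
    (𝒱 : G ⧸ H → Submodule F V) : Prop :=
  IsPair ℛ 𝒲 H 𝓕 ∧ IsGradedModule (induced (QuotientAddGroup.mk' H) ℛ) 𝒱 ∧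
  ∃ (ρ : 𝓕 →ₐ[F] F) (γ : W →ₗ[R] V), Function.Surjective γ ∧
    (∀ (c : 𝓕) (w : W), γ ((c : Centralizer R W).unop w) = ρ c • γ w) ∧
    ∀ g, ∀ w ∈ 𝒲 g, γ w ∈ 𝒱 (g : G ⧸ H)

/-- `ℰ` is an algebra grading on `End_F(V)` by `G/Z` for which the representation
`R → End_F(V)` is a homomorphism of `G/Z`-graded algebras. -/
structure IsRepGrading (ℛ : G → Submodule F R) (Z : AddSubgroup G) {V : Type*} [AddCommGroup V]
    [Module F V] [Module R V] [IsScalarTower F R V]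
    (ℰ : G ⧸ Z → Submodule F (Module.End F V)) : Prop where
  gradedAlgebra : IsGradedAlgebra ℰ
  map_mem : ∀ k, ∀ r ∈ induced (QuotientAddGroup.mk' Z) ℛ k, Algebra.lsmul F F V r ∈ ℰ k

end Modules

end GrMod

/-! Write `D` for the centralizer `C(W)` and `T` for its support. By a graded Schur lemma `D` is a
graded division algebra whose nonzero components are lines (`isGradedDivision_centGrading`). Hence
`dim D` is the order of `T`, and the hypothesis on the characteristic makes the order of every
subgroup of `T` invertible in `F`. Moreover, every nonzero submodule of `W` contains `W d` for some
nonzero `d` in `D` (`exists_range_le`), so questions about submodules of `W` become questions about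
ideals of `D`.

Let `K` be a subgroup of `T` for which the part of `D` with degrees in `K` is commutative. A
character `ρ` of this part rescales homogeneous elements into a copy of `K`, whose average is an
idempotent `ε` with `c ε = ρ(c) ε` (`exists_isCharIdempotent`). A common eigenvector of the part
acting on `Hom_R(V, W)` embeds `V` into `W ε` for a suitable `ρ` (`exists_eigenembedding`). As `ε`
has degree zero modulo `K`, the space `W ε` is graded by `G/K`. Two choices of `K` give the theorem.

For `K = H` maximal, a homogeneous element of degree outside `H` fails to commute with the part of
`H`. This forces `ε D ε = F ε`, so `D ε` is a minimal left ideal and `W ε` is simple. Hence `V ≃ W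
ε`, and `w ↦ w ε` exhibits `V` as a central image.

For `K = Z`, the part is the center. The sum of the conjugations by homogeneous units is an
invertible multiple of the projection of `D` to its center (`average_eq`), so a two-sided ideal
containing a nonzero element of `D ε` contains `ε`. Therefore `D ε` is central simple, and `V` and
`W ε` have the same annihilator in `R` (`smul_eq_zero_iff`). By Burnside's theorem `End(V)` is the
quotient of `R` by this annihilator, and it inherits the grading by `G/Z`, which is unique because
`R → End(V)` is onto. Since `W ε` is simple under the joint action of `R` and `D ε`, one gets
`End(V) ⊗ (D ε)ᵒᵖ ≃ End(W ε)`. Tensoring with `D ε` gives `D ε ⊗ End(W ε) ≃ End(V) ⊗ End(D ε)`, the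
equality of Brauer classes. Any other primitive idempotent of the center is carried to `ε` by a
graded automorphism of `D` (`exists_automorphism`). -/

namespace GrMod

/-! ### Gradings, homogeneous projections and induced gradings. -/

section Gradings

variable {F : Type*} [Field F] {G V : Type*} [AddCommGroup V] [Module F V]
  {𝒱 : G → Submodule F V}

theorem isGrading_iff : IsGrading 𝒱 ↔ iSupIndep 𝒱 ∧ iSup 𝒱 = ⊤ := by
  classical
  unfold IsGrading
  convert DirectSum.isInternal_submodule_iff_iSupIndep_and_iSup_eq_top 𝒱

theorem IsGrading.iSupIndep (h : IsGrading 𝒱) : iSupIndep 𝒱 := (isGrading_iff.mp h).1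

theorem IsGrading.iSup_eq_top (h : IsGrading 𝒱) : iSup 𝒱 = ⊤ := (isGrading_iff.mp h).2

/-- Induction on a sum of homogeneous elements. -/
theorem IsGrading.induction (h : IsGrading 𝒱) {p : V → Prop} (v : V)
    (mem : ∀ g, ∀ v ∈ 𝒱 g, p v) (zero : p 0) (add : ∀ v w, p v → p w → p (v + w)) : p v :=
  Submodule.iSup_induction 𝒱 (motive := p) (h.iSup_eq_top ▸ Submodule.mem_top : v ∈ iSup 𝒱) mem zero add

theorem IsGrading.linearMap_ext (h : IsGrading 𝒱) {X : Type*} [AddCommGroup X] [Module F X]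
    {f f' : V →ₗ[F] X} (hf : ∀ g, ∀ v ∈ 𝒱 g, f v = f' v) : f = f' := by
  ext v
  induction v using h.induction with
  | mem g v hv => exact hf g v hv
  | zero => simp
  | add v w hv hw => simp [hv, hw]

theorem IsGrading.exists_projOn (h : IsGrading 𝒱) (S : Set G) :
    ∃ P : V →ₗ[F] V, (∀ g ∈ S, ∀ v ∈ 𝒱 g, P v = v) ∧ ∀ g ∉ S, ∀ v ∈ 𝒱 g, P v = 0 := by
  have hd : Disjoint (⨆ g ∈ S, 𝒱 g) (⨆ g ∈ Sᶜ, 𝒱 g) :=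
    h.iSupIndep.disjoint_biSup_biSup disjoint_compl_right
  have hc : IsCompl (⨆ g ∈ S, 𝒱 g) (⨆ g ∈ Sᶜ, 𝒱 g) := by
    refine ⟨hd, codisjoint_iff.mpr (top_le_iff.mp ?_)⟩
    rw [← h.iSup_eq_top]
    refine iSup_le fun g => ?_
    by_cases hg : g ∈ S
    · exact le_sup_of_le_left (le_iSup₂_of_le g hg le_rfl)
    · exact le_sup_of_le_right (le_iSup₂_of_le g hg le_rfl)
  refine ⟨(⨆ g ∈ S, 𝒱 g).subtype ∘ₗ Submodule.projectionOnto _ _ hc, fun g hg v hv => ?_,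
    fun g hg v hv => ?_⟩
  · have hv' : v ∈ ⨆ g ∈ S, 𝒱 g := le_iSup₂_of_le (f := fun g (_ : g ∈ S) => 𝒱 g) g hg le_rfl hv
    exact congrArg Subtype.val (Submodule.projectionOnto_apply_left hc ⟨v, hv'⟩)
  · have hv' : v ∈ ⨆ g ∈ Sᶜ, 𝒱 g := le_iSup₂_of_le (f := fun g (_ : g ∈ Sᶜ) => 𝒱 g) g hg le_rfl hv
    exact congrArg Subtype.val (Submodule.projectionOnto_apply_right hc ⟨v, hv'⟩)

/-- The projection of a graded space onto the sum of the components with degree in `S`. -/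
noncomputable def IsGrading.projOn (h : IsGrading 𝒱) (S : Set G) : V →ₗ[F] V :=
  (h.exists_projOn S).choose

theorem IsGrading.projOn_of_mem (h : IsGrading 𝒱) {S : Set G} {g : G} (hg : g ∈ S) {v : V}
    (hv : v ∈ 𝒱 g) : h.projOn S v = v :=
  (h.exists_projOn S).choose_spec.1 g hg v hv

theorem IsGrading.projOn_of_notMem (h : IsGrading 𝒱) {S : Set G} {g : G} (hg : g ∉ S) {v : V}
    (hv : v ∈ 𝒱 g) : h.projOn S v = 0 :=
  (h.exists_projOn S).choose_spec.2 g hg v hv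

theorem IsGrading.projOn_mem (h : IsGrading 𝒱) (S : Set G) (v : V) :
    h.projOn S v ∈ ⨆ g ∈ S, 𝒱 g := by
  induction v using h.induction with
  | mem g v hv =>
    by_cases hg : g ∈ S
    · rw [h.projOn_of_mem hg hv]
      exact le_iSup₂_of_le (f := fun g (_ : g ∈ S) => 𝒱 g) g hg le_rfl hv
    · rw [h.projOn_of_notMem hg hv]; exact zero_mem _
  | zero => simp
  | add v w hv hw => rw [map_add]; exact add_mem hv hw

/-- The homogeneous component of degree `g`. -/
noncomputable abbrev IsGrading.comp (h : IsGrading 𝒱) (g : G) : V →ₗ[F] V := h.projOn {g}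

theorem IsGrading.comp_mem (h : IsGrading 𝒱) (g : G) (v : V) : h.comp g v ∈ 𝒱 g := by
  simpa using h.projOn_mem {g} v

theorem IsGrading.comp_of_mem (h : IsGrading 𝒱) {g : G} {v : V} (hv : v ∈ 𝒱 g) :
    h.comp g v = v := h.projOn_of_mem (Set.mem_singleton g) hv

theorem IsGrading.comp_of_mem_ne (h : IsGrading 𝒱) {g k : G} (hgk : k ≠ g) {v : V}
    (hv : v ∈ 𝒱 g) : h.comp k v = 0 := h.projOn_of_notMem (fun e => hgk e.symm) hv

theorem IsGrading.finite_comp_ne_zero (h : IsGrading 𝒱) (v : V) : {g | h.comp g v ≠ 0}.Finite := by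
  induction v using h.induction with
  | mem g v hv =>
    refine (Set.finite_singleton g).subset fun k hk => ?_
    by_contra hne
    exact hk (h.comp_of_mem_ne hne hv)
  | zero => simp
  | add v w hv hw =>
    refine (hv.union hw).subset fun k hk => ?_
    by_contra hne
    simp only [Set.mem_union, Set.mem_ofPred_eq, not_or, not_not] at hne
    exact hk (by rw [map_add, hne.1, hne.2, add_zero])

theorem IsGrading.sum_comp (h : IsGrading 𝒱) {v : V} {s : Finset G}
    (hs : ∀ g, h.comp g v ≠ 0 → g ∈ s) : ∑ g ∈ s, h.comp g v = v := by
  classical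
  have key : ∀ v, ∑ g ∈ (h.finite_comp_ne_zero v).toFinset, h.comp g v = v := by
    intro v
    obtain ⟨f, hf, hfv⟩ := (Submodule.mem_iSup_iff_exists_finsupp _ _).mp
      (h.iSup_eq_top ▸ Submodule.mem_top : v ∈ iSup 𝒱)
    have hc : ∀ g, h.comp g v = f g := by
      intro g
      rw [← hfv, Finsupp.sum, map_sum]
      by_cases hg : g ∈ f.support
      · rw [Finset.sum_eq_single_of_mem g hg]
        · exact h.comp_of_mem (hf g)
        · intro k _ hk
          exact h.comp_of_mem_ne hk.symm (hf k)
      · rw [Finset.sum_eq_zero, Finsupp.notMem_support_iff.mp hg]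
        intro k hk
        exact h.comp_of_mem_ne (fun e => hg (by rwa [e])) (hf k)
    conv_rhs => rw [← hfv, Finsupp.sum]
    refine Finset.sum_congr ?_ fun g _ => hc g
    ext g
    simp [hc]
  conv_rhs => rw [← key v]
  symm
  refine Finset.sum_subset (fun g hg => hs g (by simpa using hg)) fun g _ hg => ?_
  simpa using hg

theorem IsGrading.exists_comp_ne_zero (h : IsGrading 𝒱) {v : V} (hv : v ≠ 0) :
    ∃ g, h.comp g v ≠ 0 := by
  by_contra! hc
  exact hv (by simpa using (h.sum_comp (v := v) (s := ∅) fun g hg => absurd (hc g) hg).symm)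

theorem IsGrading.finite_support [FiniteDimensional F V] (h : IsGrading 𝒱) :
    (support 𝒱).Finite := WellFoundedGT.finite_ne_bot_of_iSupIndep h.iSupIndep

/-- If `f` is onto, and a linear map `g` with the same kernel takes the components of a grading to
independent subspaces, then `f` takes them to the components of a grading. -/
theorem IsGrading.map (h : IsGrading 𝒱) {X Y : Type*} [AddCommGroup X] [Module F X]
    [AddCommGroup Y] [Module F Y] {f : V →ₗ[F] X} (hf : Function.Surjective f) {g : V →ₗ[F] Y}
    (hfg : ∀ v, f v = 0 ↔ g v = 0) {ℬ : G → Submodule F Y} (hℬ : _root_.iSupIndep ℬ)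
    (hg : ∀ k, ∀ v ∈ 𝒱 k, g v ∈ ℬ k) : IsGrading fun k => (𝒱 k).map f := by
  rw [isGrading_iff]
  constructor
  · rw [iSupIndep_iff_finsetSum_eq_zero_imp_eq_zero]
    intro s x hx hsum i hi
    choose! a ha hax using hx
    rw [← hax i hi, hfg]
    refine (iSupIndep_iff_finsetSum_eq_zero_imp_eq_zero _).mp hℬ s (fun i => g (a i))
      (fun i hi => hg i _ (ha i hi)) ?_ i hi
    rw [← map_sum, ← hfg, map_sum, ← hsum]
    exact Finset.sum_congr rfl hax
  · rw [← Submodule.map_iSup, h.iSup_eq_top, Submodule.map_top, LinearMap.range_eq_top.mpr hf]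

theorem IsGrading.map_equiv (h : IsGrading 𝒱) {X : Type*} [AddCommGroup X] [Module F X]
    (f : V ≃ₗ[F] X) : IsGrading fun k => (𝒱 k).map f.toLinearMap :=
  h.map f.surjective (g := LinearMap.id) (fun v => by simp) h.iSupIndep fun _ _ hv => hv

theorem iSupIndep_endGrading [AddCommGroup G] (h : IsGrading 𝒱) : iSupIndep (endGrading 𝒱) := by
  rw [iSupIndep_iff_finsetSum_eq_zero_imp_eq_zero]
  intro s f hf hsum i hi
  refine h.linearMap_ext fun k v hv => ?_
  rw [← h.comp_of_mem (hf i hi k v hv)]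
  have := congrArg (h.comp (i + k)) (LinearMap.congr_fun hsum v)
  rw [LinearMap.sum_apply, map_sum, Finset.sum_eq_single_of_mem i hi] at this
  · simpa using this
  · intro j hj hji
    exact h.comp_of_mem_ne (fun e => hji (add_right_cancel e).symm) (hf j hj k v hv)

/-- Finite dimension makes the support finite, so `f` is a finite sum of blocks `π_a ∘ f ∘ π_b`, and
such a block has degree `a - b`. -/
theorem isGrading_endGrading [AddCommGroup G] [FiniteDimensional F V] (h : IsGrading 𝒱) :
    IsGrading (endGrading 𝒱) := by
  rw [isGrading_iff]
  refine ⟨iSupIndep_endGrading h, eq_top_iff.mpr fun f _ => ?_⟩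
  have hs : ∀ v, ∑ g ∈ h.finite_support.toFinset, h.comp g v = v := fun v =>
    h.sum_comp fun g hg => by
      simp only [Set.Finite.mem_toFinset, support, Set.mem_ofPred_eq]
      intro hb
      exact hg (by simpa [hb] using h.comp_mem g v)
  have hf : f = ∑ a ∈ h.finite_support.toFinset, ∑ b ∈ h.finite_support.toFinset,
      h.comp a ∘ₗ f ∘ₗ h.comp b := by
    ext v
    simp only [LinearMap.sum_apply, LinearMap.comp_apply]
    rw [Finset.sum_comm]
    simp only [hs, ← map_sum]
  rw [hf]
  refine sum_mem fun a _ => sum_mem fun b _ => Submodule.mem_iSup_of_mem (a - b) fun k v hv => ?_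
  simp only [LinearMap.comp_apply]
  by_cases hk : b = k
  · subst hk
    rw [sub_add_cancel]
    exact h.comp_mem a _
  · rw [h.comp_of_mem_ne hk hv]
    simp

section Induced

variable [AddCommGroup G] {K : Type*} [AddCommGroup K] (α : G →+ K)

theorem le_induced (g : G) : 𝒱 g ≤ induced α 𝒱 (α g) :=
  le_iSup₂_of_le (f := fun g' (_ : α g' = α g) => 𝒱 g') g rfl le_rfl

theorem mem_induced {g : G} {v : V} (hv : v ∈ 𝒱 g) : v ∈ induced α 𝒱 (α g) := le_induced α g hv

theorem induced_le {k : K} {N : Submodule F V} (h : ∀ g, α g = k → 𝒱 g ≤ N) :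
    induced α 𝒱 k ≤ N := iSup₂_le h

theorem IsGrading.induced (h : IsGrading 𝒱) : IsGrading (induced α 𝒱) := by
  rw [isGrading_iff]
  constructor
  · intro k
    have hd : Disjoint (⨆ g ∈ α ⁻¹' {k}, 𝒱 g) (⨆ g ∈ (α ⁻¹' {k})ᶜ, 𝒱 g) :=
      h.iSupIndep.disjoint_biSup_biSup disjoint_compl_right
    refine hd.mono le_rfl (iSup₂_le fun j hj => induced_le α fun g hg => ?_)
    exact le_iSup₂_of_le (f := fun g (_ : g ∈ (α ⁻¹' {k})ᶜ) => 𝒱 g) g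
      (fun e => hj (hg.symm.trans e)) le_rfl
  · rw [eq_top_iff, ← h.iSup_eq_top]
    exact iSup_le fun g => (le_induced α g).trans (le_iSup _ _)

end Induced

theorem map_iSup_induced [AddCommGroup G] {K : Type*} [AddCommGroup K] (α : G →+ K)
    {X : Type*} [AddCommGroup X] [Module F X] {f : V →ₗ[F] X} {k : K} {N : Submodule F X}
    (h : ∀ g, α g = k → ∀ v ∈ 𝒱 g, f v ∈ N) {v : V} (hv : v ∈ induced α 𝒱 k) : f v ∈ N :=
  (induced_le α (N := N.comap f) fun g hg v hv => h g hg v hv) hv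

theorem IsGradedAlgebra.mul_mem [AddCommGroup G] {A : Type*} [Ring A] [Algebra F A]
    {𝒜 : G → Submodule F A} (h : IsGradedAlgebra 𝒜) {i j : G} {a b : A} (ha : a ∈ 𝒜 i)
    (hb : b ∈ 𝒜 j) : a * b ∈ 𝒜 (i + j) := h.graded_mul.toGradedMul.mul_mem ha hb

theorem IsGradedAlgebra.one_mem [AddCommGroup G] {A : Type*} [Ring A] [Algebra F A]
    {𝒜 : G → Submodule F A} (h : IsGradedAlgebra 𝒜) : (1 : A) ∈ 𝒜 0 :=
  h.graded_mul.toGradedOne.one_mem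

theorem IsGradedAlgebra.induced [AddCommGroup G] {K : Type*} [AddCommGroup K] (α : G →+ K)
    {A : Type*} [Ring A] [Algebra F A] {𝒜 : G → Submodule F A} (h : IsGradedAlgebra 𝒜) :
    IsGradedAlgebra (induced α 𝒜) := by
  refine ⟨h.grading.induced α, ?_⟩
  refine { one_mem := ?_, mul_mem := fun {i j a b} ha hb => ?_ }
  · simpa using mem_induced α h.one_mem
  · refine map_iSup_induced α (f := LinearMap.mulLeft F a) (fun g hg b hb => ?_) hb
    refine map_iSup_induced α (f := LinearMap.mulRight F b) (fun g' hg' a ha => ?_) ha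
    rw [← hg, ← hg', ← map_add]
    exact mem_induced α (h.mul_mem ha hb)

theorem IsGradedModule.smul_mem [AddCommGroup G] {R : Type*} [Ring R] [Algebra F R] [Module R V]
    {ℛ : G → Submodule F R} (h : IsGradedModule ℛ 𝒱) {i j : G} {r : R} {v : V} (hr : r ∈ ℛ i)
    (hv : v ∈ 𝒱 j) : r • v ∈ 𝒱 (i + j) := h.graded_smul.smul_mem hr hv

/-- The image of an algebra grading under a surjective homomorphism with graded kernel. -/
theorem IsGradedAlgebra.map [AddCommGroup G] {A B : Type*} [Ring A] [Algebra F A] [Ring B]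
    [Algebra F B] {𝒜 : G → Submodule F A} (h : IsGradedAlgebra 𝒜) (f : A →ₐ[F] B)
    (hg : IsGrading fun k => (𝒜 k).map f.toLinearMap) :
    IsGradedAlgebra fun k => (𝒜 k).map f.toLinearMap := by
  refine ⟨hg, { one_mem := ⟨1, h.one_mem, map_one f⟩, mul_mem := ?_ }⟩
  rintro i j _ _ ⟨a, ha, rfl⟩ ⟨b, hb, rfl⟩
  exact ⟨a * b, h.mul_mem ha hb, map_mul f a b⟩

end Gradings

end GrMod

namespace GrMod

/-! ### Common eigenvectors of commuting operators. -/

section Eigenvector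

variable {F : Type*} [Field F] [IsAlgClosed F]

/-- Commuting operators on a nonzero finite-dimensional space have a common eigenvector. -/
theorem exists_common_eigenvector {C X : Type*} [Ring C] [Algebra F C]
    (hC : ∀ a b : C, a * b = b * a) [AddCommGroup X] [Module F X] [Module C X]
    [IsScalarTower F C X] [FiniteDimensional F X] [Nontrivial X] :
    ∃ ρ : C →ₐ[F] F, ∃ x : X, x ≠ 0 ∧ ∀ c : C, c • x = ρ c • x := by
  have : IsArtinian C X := isArtinian_of_tower F inferInstance
  -- On a simple submodule each element of `C` acts by a `C`-linear map because `C` is commutative,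
  -- hence by a scalar.
  obtain ⟨S, hS⟩ := IsAtomic.exists_atom (Submodule C X)
  have hSs : IsSimpleModule C S := isSimpleModule_iff_isAtom.mpr hS
  have : FiniteDimensional F S :=
    Module.Finite.equiv ((Submodule.restrictScalarsEquiv F C X S).restrictScalars F)
  have : Nontrivial S := hSs.nontrivial
  obtain ⟨x, hx⟩ := exists_ne (0 : S)
  have key : ∀ c : C, ∃ r : F, ∀ y : S, c • y = r • y := by
    intro c
    let φ : Module.End C S :=
      { toFun := fun y => c • y
        map_add' := fun y z => smul_add c y z
        map_smul' := fun d y => by simp [smul_smul, hC c d] }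
    obtain ⟨r, hr⟩ := (IsSimpleModule.algebraMap_end_bijective_of_isAlgClosed F
      (A := C) (V := S)).2 φ
    refine ⟨r, fun y => ?_⟩
    have := LinearMap.congr_fun hr y
    simpa [φ] using this.symm
  choose r hr using key
  have huniq : ∀ {a b : F}, a • x = b • x → a = b := fun h => smul_left_injective F hx h
  refine ⟨{ toFun := r, map_one' := ?_, map_mul' := ?_, map_zero' := ?_, map_add' := ?_,
            commutes' := ?_ }, x, by simpa using hx, fun c => congrArg Subtype.val (hr c x)⟩
  · exact huniq (by rw [← hr, one_smul, one_smul])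
  · intro a b
    exact huniq (by rw [← hr, mul_smul, hr b, hr a, smul_smul, mul_comm])
  · exact huniq (by rw [← hr, zero_smul, zero_smul])
  · intro a b
    exact huniq (by rw [← hr, add_smul, hr b, hr a, add_smul])
  · intro a
    exact huniq (by rw [← hr, algebraMap_smul]; rfl)

end Eigenvector

/-- A graded algebra in which the nonzero homogeneous elements are invertible and the components
are at most one-dimensional. -/
structure IsGradedDivision {F : Type*} [Field F] {G D : Type*} [AddCommGroup G] [Ring D]
    [Algebra F D] (𝒟 : G → Submodule F D) : Prop where
  gradedAlgebra : IsGradedAlgebra 𝒟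
  nontrivial : Nontrivial D
  exists_inv : ∀ g, ∀ a ∈ 𝒟 g, a ≠ 0 → ∃ b ∈ 𝒟 (-g), a * b = 1 ∧ b * a = 1
  exists_smul : ∀ g, ∀ a ∈ 𝒟 g, a ≠ 0 → ∀ b ∈ 𝒟 g, ∃ c : F, b = c • a

/-! ### Multiplication and homogeneous components. -/

section GradedMul

variable {F : Type*} [Field F] {G D : Type*} [AddCommGroup G] [Ring D] [Algebra F D]
  {𝒟 : G → Submodule F D}

theorem IsGradedAlgebra.comp_mul_left (h : IsGradedAlgebra 𝒟) {i : G} {a : D} (ha : a ∈ 𝒟 i)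
    (j : G) (x : D) : h.grading.comp (i + j) (a * x) = a * h.grading.comp j x := by
  have : h.grading.comp (i + j) ∘ₗ LinearMap.mulLeft F a
      = LinearMap.mulLeft F a ∘ₗ h.grading.comp j := by
    refine h.grading.linearMap_ext fun g x hx => ?_
    simp only [LinearMap.comp_apply, LinearMap.mulLeft_apply]
    by_cases hg : j = g
    · subst hg
      rw [h.grading.comp_of_mem hx, h.grading.comp_of_mem (h.mul_mem ha hx)]
    · rw [h.grading.comp_of_mem_ne hg hx,
        h.grading.comp_of_mem_ne (fun e => hg (add_left_cancel e)) (h.mul_mem ha hx), mul_zero]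
  exact LinearMap.congr_fun this x

theorem IsGradedAlgebra.comp_mul_right (h : IsGradedAlgebra 𝒟) {i : G} {a : D} (ha : a ∈ 𝒟 i)
    (j : G) (x : D) : h.grading.comp (i + j) (x * a) = h.grading.comp j x * a := by
  have : h.grading.comp (i + j) ∘ₗ LinearMap.mulRight F a
      = LinearMap.mulRight F a ∘ₗ h.grading.comp j := by
    refine h.grading.linearMap_ext fun g x hx => ?_
    simp only [LinearMap.comp_apply, LinearMap.mulRight_apply]
    have hm : x * a ∈ 𝒟 (i + g) := add_comm g i ▸ h.mul_mem hx ha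
    by_cases hg : j = g
    · subst hg
      rw [h.grading.comp_of_mem hx, h.grading.comp_of_mem hm]
    · rw [h.grading.comp_of_mem_ne hg hx,
        h.grading.comp_of_mem_ne (fun e => hg (add_left_cancel e)) hm, zero_mul]
  exact LinearMap.congr_fun this x

omit [AddCommGroup G] in
theorem IsGrading.comp_projOn {V : Type*} [AddCommGroup V] [Module F V] {𝒱 : G → Submodule F V}
    (h : IsGrading 𝒱) {S : Set G} {g : G} (hg : g ∈ S) (v : V) :
    h.comp g (h.projOn S v) = h.comp g v := by
  have : h.comp g ∘ₗ h.projOn S = h.comp g := by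
    refine h.linearMap_ext fun k x hx => ?_
    rw [LinearMap.comp_apply]
    by_cases hk : k ∈ S
    · rw [h.projOn_of_mem hk hx]
    · rw [h.projOn_of_notMem hk hx, map_zero, h.comp_of_mem_ne (fun e => hk (by rwa [← e])) hx]
  exact LinearMap.congr_fun this v

end GradedMul

/-! ### Graded division algebras with components of dimension at most one. -/

namespace IsGradedDivision

variable {F : Type*} [Field F] {G D : Type*} [AddCommGroup G] [Ring D] [Algebra F D]
  {𝒟 : G → Submodule F D}

theorem grading (h : IsGradedDivision 𝒟) : IsGrading 𝒟 := h.gradedAlgebra.grading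

theorem mul_ne_zero_left (h : IsGradedDivision 𝒟) {i : G} {a b : D} (ha : a ∈ 𝒟 i) (ha0 : a ≠ 0)
    (hb0 : b ≠ 0) : a * b ≠ 0 := by
  obtain ⟨c, -, -, hc⟩ := h.exists_inv i a ha ha0
  intro hab
  exact hb0 (by rw [← one_mul b, ← hc, mul_assoc, hab, mul_zero])

/-- The support of a graded division algebra, as a subgroup. -/
def supp (h : IsGradedDivision 𝒟) : AddSubgroup G where
  carrier := support 𝒟
  zero_mem' := by
    have := h.nontrivial
    exact (Submodule.ne_bot_iff _).mpr ⟨1, h.gradedAlgebra.one_mem, one_ne_zero⟩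
  add_mem' := by
    intro i j hi hj
    obtain ⟨a, ha, ha0⟩ := (Submodule.ne_bot_iff _).mp hi
    obtain ⟨b, hb, hb0⟩ := (Submodule.ne_bot_iff _).mp hj
    exact (Submodule.ne_bot_iff _).mpr ⟨a * b, h.gradedAlgebra.mul_mem ha hb,
      h.mul_ne_zero_left ha ha0 hb0⟩
  neg_mem' := by
    intro i hi
    have := h.nontrivial
    obtain ⟨a, ha, ha0⟩ := (Submodule.ne_bot_iff _).mp hi
    obtain ⟨b, hb, hab, -⟩ := h.exists_inv i a ha ha0
    refine (Submodule.ne_bot_iff _).mpr ⟨b, hb, ?_⟩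
    rintro rfl
    simp at hab

theorem mem_supp (h : IsGradedDivision 𝒟) {g : G} {a : D} (ha : a ∈ 𝒟 g) (ha0 : a ≠ 0) :
    g ∈ h.supp := (Submodule.ne_bot_iff _).mpr ⟨a, ha, ha0⟩

theorem exists_unit (h : IsGradedDivision 𝒟) (t : h.supp) :
    ∃ u : Dˣ, (u : D) ∈ 𝒟 t ∧ ((u⁻¹ : Dˣ) : D) ∈ 𝒟 (-t) := by
  obtain ⟨a, ha, ha0⟩ := (Submodule.ne_bot_iff _).mp t.2
  obtain ⟨b, hb, hab, hba⟩ := h.exists_inv t a ha ha0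
  exact ⟨⟨a, b, hab, hba⟩, ha, hb⟩

/-- A homogeneous unit of degree `t`. -/
noncomputable def unit (h : IsGradedDivision 𝒟) (t : h.supp) : Dˣ := (h.exists_unit t).choose

theorem unit_mem (h : IsGradedDivision 𝒟) (t : h.supp) : (h.unit t : D) ∈ 𝒟 t :=
  (h.exists_unit t).choose_spec.1

theorem finite_of_subset [FiniteDimensional F D] (h : IsGradedDivision 𝒟) {K : AddSubgroup G}
    (hK : (K : Set G) ⊆ support 𝒟) : Finite K := (h.grading.finite_support.subset hK).to_subtype

theorem finrank_eq (h : IsGradedDivision 𝒟) : Module.finrank F D = Nat.card h.supp := by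
  have := h.nontrivial
  have hli : LinearIndependent F fun t : h.supp => (h.unit t : D) :=
    iSupIndep.linearIndependent (fun t : h.supp => 𝒟 t)
      (h.grading.iSupIndep.comp Subtype.val_injective) h.unit_mem fun t => (h.unit t).ne_zero
  have hsp : ⊤ ≤ Submodule.span F (Set.range fun t : h.supp => (h.unit t : D)) := by
    rw [← h.grading.iSup_eq_top]
    refine iSup_le fun g d hd => ?_
    by_cases hd0 : d = 0
    · rw [hd0]; exact zero_mem _
    · obtain ⟨c, hc⟩ := h.exists_smul g _ (h.unit_mem ⟨g, h.mem_supp hd hd0⟩)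
        (h.unit _).ne_zero d hd
      rw [hc]
      exact Submodule.smul_mem _ _ (Submodule.subset_span ⟨_, rfl⟩)
  exact Module.finrank_eq_nat_card_basis (Module.Basis.mk hli hsp)

theorem card_ne_zero (h : IsGradedDivision 𝒟) (hchar : ¬ ringChar F ∣ Module.finrank F D)
    {K : AddSubgroup G} (hK : (K : Set G) ⊆ support 𝒟) : (Nat.card K : F) ≠ 0 := by
  rw [Ne, ringChar.spec]
  exact fun hd => hchar (hd.trans (h.finrank_eq ▸ AddSubgroup.card_dvd_of_le (K := h.supp) hK))

/-- Homogeneous elements commute up to a scalar. -/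
theorem exists_commutator (h : IsGradedDivision 𝒟) {i j : G} {a b : D} (ha : a ∈ 𝒟 i)
    (ha0 : a ≠ 0) (hb : b ∈ 𝒟 j) (hb0 : b ≠ 0) : ∃ c : F, b * a = c • (a * b) :=
  h.exists_smul (i + j) (a * b) (h.gradedAlgebra.mul_mem ha hb) (h.mul_ne_zero_left ha ha0 hb0)
    (b * a) (add_comm j i ▸ h.gradedAlgebra.mul_mem hb ha)

section Part

variable {K : AddSubgroup G} {𝓕 : Subalgebra F D}

theorem mem_part (h𝓕 : Subalgebra.toSubmodule 𝓕 = ⨆ k : K, 𝒟 k) {g : G} (hg : g ∈ K) {a : D}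
    (ha : a ∈ 𝒟 g) : a ∈ 𝓕 := by
  rw [← Subalgebra.mem_toSubmodule, h𝓕]
  exact Submodule.mem_iSup_of_mem (⟨g, hg⟩ : K) ha

theorem part_linearMap_ext (h𝓕 : Subalgebra.toSubmodule 𝓕 = ⨆ k : K, 𝒟 k) {X : Type*}
    [AddCommGroup X] [Module F X] {f f' : 𝓕 →ₗ[F] X}
    (hf : ∀ k : K, ∀ a : 𝓕, (a : D) ∈ 𝒟 k → f a = f' a) : f = f' := by
  ext ⟨a, ha⟩
  have ha' : a ∈ ⨆ k : K, 𝒟 k := h𝓕 ▸ ha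
  induction ha' using Submodule.iSup_induction' with
  | mem k a hak => exact hf k ⟨a, ha⟩ hak
  | zero => exact (map_zero f).trans (map_zero f').symm
  | add a b hxa hxb iha ihb =>
    have hma : a ∈ 𝓕 := by rw [← Subalgebra.mem_toSubmodule, h𝓕]; exact hxa
    have hmb : b ∈ 𝓕 := by rw [← Subalgebra.mem_toSubmodule, h𝓕]; exact hxb
    have : (⟨a + b, ha⟩ : 𝓕) = ⟨a, hma⟩ + ⟨b, hmb⟩ := rfl
    rw [this, map_add, map_add, iha hma, ihb hmb]

theorem projOn_part (h : IsGradedDivision 𝒟) (h𝓕 : Subalgebra.toSubmodule 𝓕 = ⨆ k : K, 𝒟 k)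
    (a : 𝓕) : h.grading.projOn K (a : D) = a := by
  have : h.grading.projOn K ∘ₗ (Subalgebra.toSubmodule 𝓕).subtype
      = (Subalgebra.toSubmodule 𝓕).subtype :=
    part_linearMap_ext (𝓕 := 𝓕) h𝓕 fun k a ha => h.grading.projOn_of_mem k.2 ha
  exact LinearMap.congr_fun this a

theorem projOn_mem_part (h : IsGradedDivision 𝒟)
    (h𝓕 : Subalgebra.toSubmodule 𝓕 = ⨆ k : K, 𝒟 k) (d : D) : h.grading.projOn K d ∈ 𝓕 := by
  rw [← Subalgebra.mem_toSubmodule, h𝓕]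
  exact (iSup₂_le fun g hg => le_iSup (fun k : K => 𝒟 k) ⟨g, hg⟩ :
    ⨆ g ∈ (K : Set G), 𝒟 g ≤ ⨆ k : K, 𝒟 k) (h.grading.projOn_mem K d)

theorem degree_mem_of_mem_part (h : IsGradedDivision 𝒟)
    (h𝓕 : Subalgebra.toSubmodule 𝓕 = ⨆ k : K, 𝒟 k) {g : G} {a : D} (ha : a ∈ 𝒟 g) (ha0 : a ≠ 0)
    (ha𝓕 : a ∈ 𝓕) : g ∈ K := by
  by_contra hg
  exact ha0 ((h.projOn_part h𝓕 ⟨a, ha𝓕⟩).symm.trans (h.grading.projOn_of_notMem hg ha))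

/-- Right multiplication by an element with degrees in `K` preserves the cosets of `K`. The
projection is thus a conditional expectation onto `𝓕`. -/
theorem projOn_mul_part (h : IsGradedDivision 𝒟)
    (h𝓕 : Subalgebra.toSubmodule 𝓕 = ⨆ k : K, 𝒟 k) (d : D) (a : 𝓕) :
    h.grading.projOn K (d * a) = h.grading.projOn K d * a := by
  have : h.grading.projOn K ∘ₗ LinearMap.mulLeft F d ∘ₗ (Subalgebra.toSubmodule 𝓕).subtype
      = LinearMap.mulLeft F (h.grading.projOn K d) ∘ₗ (Subalgebra.toSubmodule 𝓕).subtype := by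
    refine part_linearMap_ext (𝓕 := 𝓕) h𝓕 fun k a ha => ?_
    have : h.grading.projOn K ∘ₗ LinearMap.mulRight F (a : D)
        = LinearMap.mulRight F (a : D) ∘ₗ h.grading.projOn K := by
      refine h.grading.linearMap_ext fun g x hx => ?_
      simp only [LinearMap.comp_apply, LinearMap.mulRight_apply]
      by_cases hg : g ∈ K
      · rw [h.grading.projOn_of_mem hg hx,
          h.grading.projOn_of_mem (K.add_mem hg k.2) (h.gradedAlgebra.mul_mem hx ha)]
      · rw [h.grading.projOn_of_notMem hg hx, zero_mul, h.grading.projOn_of_notMem (g := g + k)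
          (fun hgk => hg ((K.add_mem_cancel_right k.2).mp hgk)) (h.gradedAlgebra.mul_mem hx ha)]
    exact LinearMap.congr_fun this d
  exact LinearMap.congr_fun this a

theorem algHom_ne_zero (h : IsGradedDivision 𝒟) (h𝓕 : Subalgebra.toSubmodule 𝓕 = ⨆ k : K, 𝒟 k)
    (ρ : 𝓕 →ₐ[F] F) {k : K} {a : 𝓕} (ha : (a : D) ∈ 𝒟 k) (ha0 : a ≠ 0) : ρ a ≠ 0 := by
  obtain ⟨b, hb, hab, -⟩ := h.exists_inv k a ha (by simpa using ha0)
  intro hρ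
  have : a * ⟨b, mem_part h𝓕 (K.neg_mem k.2) hb⟩ = 1 := Subtype.ext hab
  simpa [hρ] using congrArg ρ this

theorem exists_normalized (h : IsGradedDivision 𝒟) (hK : (K : Set G) ⊆ support 𝒟)
    (h𝓕 : Subalgebra.toSubmodule 𝓕 = ⨆ k : K, 𝒟 k) (ρ : 𝓕 →ₐ[F] F) (k : K) :
    ∃ y : 𝓕, (y : D) ∈ 𝒟 k ∧ ρ y = 1 := by
  have hk : (k : G) ∈ h.supp := hK k.2
  have hρ := h.algHom_ne_zero h𝓕 ρ (k := k) (a := ⟨h.unit ⟨k, hk⟩, mem_part h𝓕 k.2 (h.unit_mem ⟨k, hk⟩)⟩)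
    (h.unit_mem ⟨k, hk⟩) (by
      have := h.nontrivial
      exact fun e => (h.unit ⟨k, hk⟩).ne_zero (congrArg Subtype.val e))
  exact ⟨(ρ _)⁻¹ • _, Submodule.smul_mem _ _ (h.unit_mem ⟨k, hk⟩),
    by rw [map_smul, smul_eq_mul, inv_mul_cancel₀ hρ]⟩

theorem eq_smul_of_algHom_eq_one (h : IsGradedDivision 𝒟) (ρ : 𝓕 →ₐ[F] F) {k : G} {y a : 𝓕}
    (hy : (y : D) ∈ 𝒟 k) (hρ : ρ y = 1) (ha : (a : D) ∈ 𝒟 k) : a = ρ a • y := by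
  have hy0 : (y : D) ≠ 0 := by
    intro e
    have : y = 0 := Subtype.ext e
    simp [this] at hρ
  obtain ⟨c, hc⟩ := h.exists_smul k y hy hy0 a ha
  have hc' : a = c • y := Subtype.ext hc
  rw [hc', map_smul, hρ, smul_eq_mul, mul_one]

/-- Elements `Y k ∈ 𝓕` of degree `k` that multiply like the elements of `K`. -/
theorem exists_multiplicative_basis (h : IsGradedDivision 𝒟) (hK : (K : Set G) ⊆ support 𝒟)
    (h𝓕 : Subalgebra.toSubmodule 𝓕 = ⨆ k : K, 𝒟 k) (ρ : 𝓕 →ₐ[F] F) :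
    ∃ Y : K → 𝓕, (∀ k : K, (Y k : D) ∈ 𝒟 k) ∧ (∀ k, ρ (Y k) = 1) ∧ Y 0 = 1 ∧
      (∀ k l : K, Y (k + l) = Y k * Y l) ∧
      ∀ (k : K) (a : 𝓕), (a : D) ∈ 𝒟 k → a = ρ a • Y k := by
  choose Y hY hρ using h.exists_normalized hK h𝓕 ρ
  -- On a line `𝒟 k` an element is determined by its value under `ρ`. Hence the normalized elements
  -- multiply without a cocycle.
  have hsmul : ∀ (k : K) (a : 𝓕), (a : D) ∈ 𝒟 k → a = ρ a • Y k :=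
    fun k a ha => h.eq_smul_of_algHom_eq_one ρ (hY k) (hρ k) ha
  refine ⟨Y, hY, hρ, ?_, fun k l => ?_, hsmul⟩
  · simpa using (hsmul 0 1 h.gradedAlgebra.one_mem).symm
  · simpa [hρ] using (hsmul (k + l) (Y k * Y l) (h.gradedAlgebra.mul_mem (hY k) (hY l))).symm

end Part

end IsGradedDivision

end GrMod

/-! ### Idempotents of characters. -/

namespace GrMod

/-- `ε` spans the eigenspace of the character `ρ` of the algebra `𝓕`. -/
structure IsCharIdempotent {F 𝓕 : Type*} [Field F] [Ring 𝓕] [Algebra F 𝓕] (ρ : 𝓕 →ₐ[F] F)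
    (ε : 𝓕) : Prop where
  map_eq : ρ ε = 1
  mul_eq : ∀ c, c * ε = ρ c • ε
  mul_eq' : ∀ c, ε * c = ρ c • ε

namespace IsCharIdempotent

variable {F 𝓕 : Type*} [Field F] [Ring 𝓕] [Algebra F 𝓕] {ρ : 𝓕 →ₐ[F] F} {ε : 𝓕}

theorem idem (hε : IsCharIdempotent ρ ε) : IsIdempotentElem ε := by
  rw [IsIdempotentElem, hε.mul_eq, hε.map_eq, one_smul]

theorem ne_zero (hε : IsCharIdempotent ρ ε) : ε ≠ 0 := by
  rintro rfl
  simpa using hε.map_eq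

theorem isPrimitiveIdempotent (hε : IsCharIdempotent ρ ε) : IsPrimitiveIdempotent ε := by
  refine ⟨hε.idem, hε.ne_zero, fun a b ha hb hab hba he => ?_⟩
  have ha' : a = ρ a • ε := by rw [← hε.mul_eq, ← he, mul_add, ha, hab, add_zero]
  have hb' : b = ρ b • ε := by rw [← hε.mul_eq, ← he, mul_add, hb, hba, zero_add]
  have : ρ a * ρ b = 0 := by rw [← map_mul, hab, map_zero]
  rcases mul_eq_zero.mp this with h0 | h0
  · left; rw [ha', h0, zero_smul]
  · right; rw [hb', h0, zero_smul]

end IsCharIdempotent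

/-- The ideal generated by `ε` contains a common eigenvector, and `ε` acts on this ideal as the
identity, so its eigenvalue is one. -/
theorem exists_algHom_eq_one_of_isIdempotentElem {F C : Type*} [Field F] [IsAlgClosed F]
    [CommRing C] [Algebra F C] [FiniteDimensional F C] {ε : C} (hε : IsIdempotentElem ε)
    (hε0 : ε ≠ 0) : ∃ ρ : C →ₐ[F] F, ρ ε = 1 := by
  have : Nontrivial (Ideal.span {ε}) :=
    ⟨⟨⟨ε, Ideal.mem_span_singleton_self ε⟩, 0, fun e => hε0 (congrArg Subtype.val e)⟩⟩
  have : FiniteDimensional F (Ideal.span {ε}) :=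
    FiniteDimensional.of_injective ((Ideal.span {ε}).subtype.restrictScalars F)
      Subtype.val_injective
  obtain ⟨ρ, ⟨x, hx⟩, hx0, hρ⟩ := exists_common_eigenvector (F := F) (C := C)
    (X := Ideal.span {ε}) mul_comm
  refine ⟨ρ, ?_⟩
  obtain ⟨c, rfl⟩ := Ideal.mem_span_singleton'.mp hx
  have h1 := congrArg Subtype.val (hρ ε)
  have h2 : ε * (c * ε) = c * ε := by rw [mul_left_comm, hε]
  simp only [Submodule.coe_smul, smul_eq_mul, h2] at h1
  have h3 : (1 - ρ ε) • (c * ε) = 0 := by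
    rw [sub_smul, one_smul, sub_eq_zero]
    exact h1
  rcases smul_eq_zero.mp h3 with h | h
  · exact (sub_eq_zero.mp h).symm
  · exact absurd (Subtype.ext h) hx0

namespace IsGradedDivision

variable {F : Type*} [Field F] {G D : Type*} [AddCommGroup G] [Ring D] [Algebra F D]
  {𝒟 : G → Submodule F D}

section Part

variable {K : AddSubgroup G} {𝓕 : Subalgebra F D}

/-- The idempotent is the average of the elements `Y k` normalized by `ρ (Y k) = 1`: multiplication
by one of them permutes the summands. -/
theorem exists_isCharIdempotent [FiniteDimensional F D] (h : IsGradedDivision 𝒟)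
    (hK : (K : Set G) ⊆ support 𝒟) (h𝓕 : Subalgebra.toSubmodule 𝓕 = ⨆ k : K, 𝒟 k)
    (hcard : (Nat.card K : F) ≠ 0) (ρ : 𝓕 →ₐ[F] F) : ∃ ε, IsCharIdempotent ρ ε := by
  have := h.finite_of_subset hK
  have := Fintype.ofFinite K
  obtain ⟨Y, hY, hρ, -, hmul, hsmul⟩ := h.exists_multiplicative_basis hK h𝓕 ρ
  rw [Nat.card_eq_fintype_card] at hcard
  refine ⟨(Fintype.card K : F)⁻¹ • ∑ k, Y k, ?_, fun c => ?_, fun c => ?_⟩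
  · simp [hρ, hcard]
  · have : LinearMap.mulRight F ((Fintype.card K : F)⁻¹ • ∑ k, Y k)
        = (LinearMap.toSpanSingleton F 𝓕 ((Fintype.card K : F)⁻¹ • ∑ k, Y k)) ∘ₗ ρ.toLinearMap := by
      refine part_linearMap_ext h𝓕 fun k a ha => ?_
      simp only [LinearMap.mulRight_apply, LinearMap.comp_apply, LinearMap.toSpanSingleton_apply,
        AlgHom.toLinearMap_apply]
      conv_lhs => rw [hsmul k a ha]
      rw [smul_mul_assoc, mul_smul_comm, Finset.mul_sum]
      congr 2
      simp only [← hmul]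
      exact Fintype.sum_equiv (Equiv.addLeft k) _ _ fun _ => rfl
    exact LinearMap.congr_fun this c
  · have : LinearMap.mulLeft F ((Fintype.card K : F)⁻¹ • ∑ k, Y k)
        = (LinearMap.toSpanSingleton F 𝓕 ((Fintype.card K : F)⁻¹ • ∑ k, Y k)) ∘ₗ ρ.toLinearMap := by
      refine part_linearMap_ext h𝓕 fun k a ha => ?_
      simp only [LinearMap.mulLeft_apply, LinearMap.comp_apply, LinearMap.toSpanSingleton_apply,
        AlgHom.toLinearMap_apply]
      conv_lhs => rw [hsmul k a ha]
      rw [mul_smul_comm, smul_mul_assoc, Finset.sum_mul]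
      congr 2
      simp only [← hmul]
      exact Fintype.sum_equiv (Equiv.addRight k) _ _ fun _ => rfl
    exact LinearMap.congr_fun this c

theorem exists_groupAlgebra_equiv (h : IsGradedDivision 𝒟) (hK : (K : Set G) ⊆ support 𝒟)
    (h𝓕 : Subalgebra.toSubmodule 𝓕 = ⨆ k : K, 𝒟 k) (ρ : 𝓕 →ₐ[F] F) :
    ∃ e : AddMonoidAlgebra F K ≃ₐ[F] 𝓕,
      ∀ k : K, (e (AddMonoidAlgebra.single k 1) : D) ∈ 𝒟 k := by
  obtain ⟨Y, hY, hρ, hone, hmul, hsmul⟩ := h.exists_multiplicative_basis hK h𝓕 ρ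
  let φ : Multiplicative K →* 𝓕 :=
    { toFun := fun k => Y k.toAdd, map_one' := hone, map_mul' := fun k l => hmul _ _ }
  let e := AddMonoidAlgebra.lift F 𝓕 K φ
  have he : ∀ k : K, e (AddMonoidAlgebra.single k 1) = Y k := fun k => by
    simp [e, φ, AddMonoidAlgebra.lift_single]
  -- The component of degree `k` of the image recovers the coefficient at `k`, which gives
  -- injectivity.
  have hcomp : ∀ (k : K) (f : AddMonoidAlgebra F K),
      h.grading.comp (k : G) (e f : D) = f.coeff k • (Y k : D) := by
    intro k f
    induction f using AddMonoidAlgebra.induction_linear with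
    | zero => simp
    | add f g hf hg => simp [hf, hg, add_smul]
    | single l c =>
      have : (AddMonoidAlgebra.single l c : AddMonoidAlgebra F K)
          = c • AddMonoidAlgebra.single l 1 := by simp
      rw [this, map_smul, he, Subalgebra.coe_smul, map_smul]
      by_cases hkl : l = k
      · subst hkl
        rw [h.grading.comp_of_mem (hY l)]
        simp
      · rw [h.grading.comp_of_mem_ne (fun e => hkl (Subtype.ext e).symm) (hY l)]
        simp [hkl]
  have hY0 : ∀ k, (Y k : D) ≠ 0 := by
    intro k e
    have : Y k = 0 := Subtype.ext e
    simpa [this] using hρ k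
  have hinj : Function.Injective e := by
    rw [injective_iff_map_eq_zero]
    intro f hf
    ext k
    have := hcomp k f
    rw [hf, ZeroMemClass.coe_zero, map_zero] at this
    simpa [hY0 k] using this.symm
  have hsurj : Function.Surjective e := by
    rw [← AlgHom.range_eq_top, ← top_le_iff]
    have : (AlgHom.range e).toSubmodule.mkQ = 0 := by
      refine part_linearMap_ext h𝓕 fun k a ha => ?_
      rw [LinearMap.zero_apply, Submodule.mkQ_apply, Submodule.Quotient.mk_eq_zero, hsmul k a ha]
      exact Submodule.smul_mem _ _ ⟨_, he k⟩
    intro a _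
    have := LinearMap.congr_fun this a
    rwa [LinearMap.zero_apply, Submodule.mkQ_apply, Submodule.Quotient.mk_eq_zero] at this
  refine ⟨AlgEquiv.ofBijective e ⟨hinj, hsurj⟩, fun k => ?_⟩
  have : AlgEquiv.ofBijective e ⟨hinj, hsurj⟩ (AddMonoidAlgebra.single k 1) = Y k := he k
  rw [this]
  exact hY k

end Part

/-! ### Maximal commutative parts and their corners. -/

section Maximal

variable {H : AddSubgroup G}

/-- Adjoining `g` to `H` keeps the part commutative: every element of degree in `H + ℤ g` is a
homogeneous element with degree in `H` times a power of the unit `a`. -/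
theorem mem_of_commute_of_maximal (h : IsGradedDivision 𝒟)
    (hmax : Maximal (fun K : AddSubgroup G => (K : Set G) ⊆ support 𝒟 ∧
      ∀ a ∈ ⨆ k : K, 𝒟 k, ∀ b ∈ ⨆ k : K, 𝒟 k, a * b = b * a) H)
    {g : G} {a : D} (ha : a ∈ 𝒟 g) (ha0 : a ≠ 0)
    (hcomm : ∀ k ∈ H, ∀ b ∈ 𝒟 k, a * b = b * a) : g ∈ H := by
  have hg := h.mem_supp ha ha0
  obtain ⟨a', ha', haa', ha'a⟩ := h.exists_inv g a ha ha0
  let u : Dˣ := ⟨a, a', haa', ha'a⟩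
  have hpow : ∀ n : ℤ, ((u ^ n : Dˣ) : D) ∈ 𝒟 (n • g) := by
    intro n
    induction n using Int.induction_on with
    | zero => simpa using h.gradedAlgebra.one_mem
    | succ n ih =>
      rw [zpow_add_one, Units.val_mul, add_smul, one_smul]
      exact h.gradedAlgebra.mul_mem ih ha
    | pred n ih =>
      rw [zpow_sub_one, Units.val_mul, sub_smul, one_smul, sub_eq_add_neg]
      exact h.gradedAlgebra.mul_mem ih ha'
  have hform : ∀ k ∈ H ⊔ AddSubgroup.zmultiples g, ∀ c ∈ 𝒟 k, ∃ l ∈ H, ∃ b ∈ 𝒟 l, ∃ n : ℤ,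
      c = b * (u ^ n : Dˣ) := by
    intro k hk c hc
    obtain ⟨l, hl, m, ⟨n, rfl⟩, rfl⟩ := AddSubgroup.mem_sup.mp hk
    refine ⟨l, hl, c * (u ^ (-n) : Dˣ), ?_, n, ?_⟩
    · have := h.gradedAlgebra.mul_mem hc (hpow (-n))
      simpa using this
    · rw [mul_assoc, ← Units.val_mul, ← zpow_add, neg_add_cancel, zpow_zero, Units.val_one, mul_one]
  have hHcomm : ∀ k ∈ H, ∀ b ∈ 𝒟 k, ∀ l ∈ H, ∀ c ∈ 𝒟 l, b * c = c * b := fun k hk b hb l hl c hc =>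
    hmax.prop.2 b (Submodule.mem_iSup_of_mem (⟨k, hk⟩ : H) hb) c
      (Submodule.mem_iSup_of_mem (⟨l, hl⟩ : H) hc)
  have hmain : ∀ k ∈ H ⊔ AddSubgroup.zmultiples g, ∀ c ∈ 𝒟 k,
      ∀ l ∈ H ⊔ AddSubgroup.zmultiples g, ∀ d ∈ 𝒟 l, Commute c d := by
    intro k hk c hc l hl d hd
    obtain ⟨k', hk', b, hb, n, rfl⟩ := hform k hk c hc
    obtain ⟨l', hl', b', hb', n', rfl⟩ := hform l hl d hd
    have hu : ∀ k ∈ H, ∀ b ∈ 𝒟 k, ∀ n : ℤ, Commute b (u ^ n : Dˣ) := fun k hk b hb n =>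
      Commute.units_zpow_right (a := b) (u := u) (hcomm k hk b hb).symm n
    refine Commute.mul_left (Commute.mul_right (hHcomm _ hk' _ hb _ hl' _ hb') (hu _ hk' _ hb _))
      (Commute.mul_right (hu _ hl' _ hb' _).symm ?_)
    exact congrArg Units.val ((Commute.refl u).zpow_zpow n n')
  have hle : H ⊔ AddSubgroup.zmultiples g ≤ H := by
    refine hmax.le_of_ge ⟨?_, fun c hc d hd => ?_⟩ le_sup_left
    · have : H ⊔ AddSubgroup.zmultiples g ≤ h.supp :=
        sup_le hmax.prop.1 ((AddSubgroup.zmultiples_le).mpr hg)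
      exact this
    · induction hc using Submodule.iSup_induction' with
      | zero => simp
      | add x y _ _ hx hy => rw [add_mul, mul_add, hx, hy]
      | mem k c hc =>
        induction hd using Submodule.iSup_induction' with
        | zero => simp
        | add x y _ _ hx hy => rw [add_mul, mul_add, hx, hy]
        | mem l d hd => exact hmain k k.2 c hc l l.2 d hd
  exact hle (AddSubgroup.mem_sup_right (AddSubgroup.mem_zmultiples g))

variable {𝓕 : Subalgebra F D}

/-- The homogeneous elements of a larger graded subfield commute with `𝓕`, so
`mem_of_commute_of_maximal` puts their degrees in `H`. -/
theorem maximal_isGradedSubfield (h : IsGradedDivision 𝒟)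
    (hmax : Maximal (fun K : AddSubgroup G => (K : Set G) ⊆ support 𝒟 ∧
      ∀ a ∈ ⨆ k : K, 𝒟 k, ∀ b ∈ ⨆ k : K, 𝒟 k, a * b = b * a) H)
    (h𝓕 : Subalgebra.toSubmodule 𝓕 = ⨆ k : H, 𝒟 k) : Maximal (IsGradedSubfield 𝒟) 𝓕 := by
  refine ⟨⟨le_antisymm ?_ (iSup_le fun g => inf_le_left), fun a ha b hb => ?_,
    fun g a ha hag ha0 => ?_⟩, fun S hS hle => ?_⟩
  · conv_lhs => rw [h𝓕]
    refine iSup_le fun k => le_iSup_of_le (k : G) (le_inf ?_ le_rfl)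
    exact fun a ha => mem_part h𝓕 k.2 ha
  · rw [← Subalgebra.mem_toSubmodule, h𝓕] at ha hb
    exact hmax.prop.2 a ha b hb
  · obtain ⟨b, hb, hab, -⟩ := h.exists_inv g a hag ha0
    exact ⟨b, mem_part h𝓕 (H.neg_mem (h.degree_mem_of_mem_part h𝓕 hag ha0 ha)) hb, hab⟩
  · change Subalgebra.toSubmodule S ≤ Subalgebra.toSubmodule 𝓕
    rw [hS.graded]
    refine iSup_le fun g a ⟨haS, hag⟩ => ?_
    by_cases ha0 : a = 0
    · rw [ha0]; exact zero_mem _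
    · exact mem_part h𝓕 (h.mem_of_commute_of_maximal hmax hag ha0 fun k hk b hb =>
        hS.comm a haS b (hle (mem_part h𝓕 hk hb))) hag

/-- By maximality some `b` of degree in `H` satisfies `d b = c b d` with `c ≠ 1`. Evaluating `ε d b
ε` by absorbing `b` into the right or the left `ε` gives `ρ(b) ε d ε = c ρ(b) ε d ε`. -/
theorem corner_scalar (h : IsGradedDivision 𝒟)
    (hmax : Maximal (fun K : AddSubgroup G => (K : Set G) ⊆ support 𝒟 ∧
      ∀ a ∈ ⨆ k : K, 𝒟 k, ∀ b ∈ ⨆ k : K, 𝒟 k, a * b = b * a) H)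
    (h𝓕 : Subalgebra.toSubmodule 𝓕 = ⨆ k : H, 𝒟 k) {ρ : 𝓕 →ₐ[F] F} {ε : 𝓕}
    (hε : IsCharIdempotent ρ ε) {g : G} (hg : g ∉ H) {d : D} (hd : d ∈ 𝒟 g) :
    (ε : D) * d * ε = 0 := by
  by_cases hd0 : d = 0
  · simp [hd0]
  have : ∃ k ∈ H, ∃ b ∈ 𝒟 k, d * b ≠ b * d := by
    by_contra! hc
    exact hg (h.mem_of_commute_of_maximal hmax hd hd0 hc)
  obtain ⟨k, hk, b, hb, hne⟩ := this
  have hb0 : b ≠ 0 := by rintro rfl; simp at hne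
  obtain ⟨c, hc⟩ := h.exists_commutator hb hb0 hd hd0
  have hc1 : c ≠ 1 := by rintro rfl; exact hne (by rw [hc, one_smul])
  let b' : 𝓕 := ⟨b, mem_part h𝓕 hk hb⟩
  have hρ : ρ b' ≠ 0 := h.algHom_ne_zero h𝓕 ρ (k := ⟨k, hk⟩) hb
    fun e => hb0 (congrArg Subtype.val e)
  have h1 : (b : D) * ε = ρ b' • (ε : D) := congrArg Subtype.val (hε.mul_eq b')
  have h2 : (ε : D) * b = ρ b' • (ε : D) := congrArg Subtype.val (hε.mul_eq' b')
  have h3 : ρ b' • ((ε : D) * d * ε) = c • ρ b' • ((ε : D) * d * ε) := by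
    calc ρ b' • ((ε : D) * d * ε) = ε * (d * b) * ε := by
          rw [← mul_smul_comm, ← h1]; simp only [mul_assoc]
      _ = c • ((ε * b) * d * ε) := by
          rw [hc, mul_smul_comm, smul_mul_assoc]; simp only [mul_assoc]
      _ = _ := by rw [h2, smul_mul_assoc, smul_mul_assoc]
  have h4 : ((1 - c) * ρ b') • ((ε : D) * d * ε) = 0 := by
    rw [mul_smul, sub_smul, one_smul, ← h3, sub_self]
  exact (smul_eq_zero.mp h4).resolve_left (mul_ne_zero (sub_ne_zero.mpr hc1.symm) hρ)

/-- This is `ε D ε = F ε` with the scalar made explicit: components outside `H` die by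
`corner_scalar`, and `ρ` evaluates the rest. -/
theorem corner_mul_projOn (h : IsGradedDivision 𝒟)
    (hmax : Maximal (fun K : AddSubgroup G => (K : Set G) ⊆ support 𝒟 ∧
      ∀ a ∈ ⨆ k : K, 𝒟 k, ∀ b ∈ ⨆ k : K, 𝒟 k, a * b = b * a) H)
    (h𝓕 : Subalgebra.toSubmodule 𝓕 = ⨆ k : H, 𝒟 k) {ρ : 𝓕 →ₐ[F] F} {ε : 𝓕}
    (hε : IsCharIdempotent ρ ε) (d : D) :
    (ε : D) * d * ε = ρ ⟨h.grading.projOn H d, h.projOn_mem_part h𝓕 d⟩ • (ε : D) := by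
  have h1 : (ε : D) * d * ε = ε * h.grading.projOn H d * ε := by
    induction d using h.grading.induction with
    | mem g d hd =>
      by_cases hg : g ∈ H
      · rw [h.grading.projOn_of_mem hg hd]
      · rw [h.grading.projOn_of_notMem hg hd, h.corner_scalar hmax h𝓕 hε hg hd]
        simp
    | zero => simp
    | add x y hx hy => simp only [map_add, mul_add, add_mul, hx, hy]
  rw [h1]
  have h2 : (ε : D) * h.grading.projOn H d = ρ ⟨h.grading.projOn H d, h.projOn_mem_part h𝓕 d⟩ • ε :=
    congrArg Subtype.val (hε.mul_eq' ⟨_, h.projOn_mem_part h𝓕 d⟩)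
  rw [h2, smul_mul_assoc]
  exact congrArg _ (congrArg Subtype.val hε.idem)

/-- Multiplying by the inverse of a nonzero component of `d` produces an element whose component of
degree zero is `1`. -/
theorem exists_homogeneous_mul (h : IsGradedDivision 𝒟) {K : AddSubgroup G} {d : D} (hd : d ≠ 0) :
    ∃ d' : D, h.grading.projOn K (d' * d) ≠ 0 := by
  obtain ⟨t, ht⟩ := h.grading.exists_comp_ne_zero hd
  obtain ⟨b, hb, -, hba⟩ := h.exists_inv t _ (h.grading.comp_mem t d) ht
  refine ⟨b, fun e => ?_⟩
  have h1 := h.gradedAlgebra.comp_mul_left hb t d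
  rw [hba, neg_add_cancel, ← h.grading.comp_projOn (S := K) K.zero_mem, e, map_zero] at h1
  have := h.nontrivial
  exact zero_ne_one h1

/-- This says that `D ε` is a minimal left ideal. After a shift, the projection of `d' d` to `𝓕` is
nonzero; it is also a multiple of `ε` because `d = d ε`, so `ρ` does not vanish on it and `ε d' d =
ε d' d ε` is a nonzero multiple of `ε`. -/
theorem exists_corner_mul_eq (h : IsGradedDivision 𝒟)
    (hmax : Maximal (fun K : AddSubgroup G => (K : Set G) ⊆ support 𝒟 ∧
      ∀ a ∈ ⨆ k : K, 𝒟 k, ∀ b ∈ ⨆ k : K, 𝒟 k, a * b = b * a) H)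
    (h𝓕 : Subalgebra.toSubmodule 𝓕 = ⨆ k : H, 𝒟 k) {ρ : 𝓕 →ₐ[F] F} {ε : 𝓕}
    (hε : IsCharIdempotent ρ ε) {d : D} (hd : d ≠ 0) (hdε : d * ε = d) :
    ∃ d', (ε : D) * d' * d = ε := by
  obtain ⟨d', hd'⟩ := h.exists_homogeneous_mul (K := H) hd
  have hmem := h.projOn_mem_part h𝓕 (d' * d)
  have h1 : h.grading.projOn H (d' * d) = ρ ⟨_, hmem⟩ • (ε : D) := by
    conv_lhs => rw [← hdε, ← mul_assoc, h.projOn_mul_part h𝓕]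
    exact congrArg Subtype.val (hε.mul_eq ⟨_, hmem⟩)
  have hρ : ρ ⟨_, hmem⟩ ≠ 0 := fun e => hd' (by rw [h1, e, zero_smul])
  refine ⟨(ρ ⟨_, hmem⟩)⁻¹ • d', ?_⟩
  rw [mul_smul_comm, smul_mul_assoc, inv_smul_eq_iff₀ hρ, ← h.corner_mul_projOn hmax h𝓕 hε,
    mul_assoc, mul_assoc, mul_assoc, hdε]

end Maximal

end IsGradedDivision

end GrMod

/-! ### The center of a graded division algebra. -/

namespace GrMod

/-- Otherwise `ε = η + (ε - η)` would be a proper orthogonal decomposition. -/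
theorem IsPrimitiveIdempotent.eq_of_mul_eq {A : Type*} [Ring A] {ε η : A}
    (hε : IsPrimitiveIdempotent ε) (hη : IsIdempotentElem η) (hη0 : η ≠ 0) (h1 : ε * η = η)
    (h2 : η * ε = η) : η = ε := by
  have hεε : ε * ε = ε := hε.idem
  have hηη : η * η = η := hη
  rcases hε.indecomposable η (ε - η) hη
    (by rw [IsIdempotentElem, sub_mul, mul_sub, mul_sub, hεε, h1, h2, hηη]; abel)
    (by rw [mul_sub, h2, hηη, sub_self]) (by rw [sub_mul, h1, hηη, sub_self]) (by abel)
    with h0 | h0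
  · exact absurd h0 hη0
  · exact (sub_eq_zero.mp h0).symm

namespace IsGradedDivision

variable {F : Type*} [Field F] {G D : Type*} [AddCommGroup G] [Ring D] [Algebra F D]
  {𝒟 : G → Submodule F D}

/-- As `G` is abelian, left and right multiplication by a homogeneous element shift degrees equally,
so commutation can be compared component by component. -/
theorem comp_mem_center (h : IsGradedDivision 𝒟) {c : D} (hc : c ∈ Subalgebra.center F D) (g : G) :
    h.grading.comp g c ∈ Subalgebra.center F D := by
  rw [Subalgebra.mem_center_iff] at hc ⊢
  intro d
  induction d using h.grading.induction with
  | mem j d hd =>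
    rw [← h.gradedAlgebra.comp_mul_left hd, hc, h.gradedAlgebra.comp_mul_right hd]
  | zero => simp
  | add x y hx hy => rw [add_mul, mul_add, hx, hy]

theorem le_center (h : IsGradedDivision 𝒟) {g : G} {a : D} (hac : a ∈ Subalgebra.center F D)
    (ha : a ∈ 𝒟 g) (ha0 : a ≠ 0) : 𝒟 g ≤ Subalgebra.toSubmodule (Subalgebra.center F D) := by
  intro b hb
  obtain ⟨c, rfl⟩ := h.exists_smul g a ha ha0 b hb
  exact Submodule.smul_mem _ c hac

/-- The support of the center, as a subgroup. -/
def centerSupp (h : IsGradedDivision 𝒟) : AddSubgroup G where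
  carrier := support fun g => Subalgebra.toSubmodule (Subalgebra.center F D) ⊓ 𝒟 g
  zero_mem' := by
    have := h.nontrivial
    exact (Submodule.ne_bot_iff _).mpr ⟨1, ⟨one_mem (Subalgebra.center F D),
      h.gradedAlgebra.one_mem⟩, one_ne_zero⟩
  add_mem' := by
    intro i j hi hj
    obtain ⟨a, ⟨hac, ha⟩, ha0⟩ := (Submodule.ne_bot_iff _).mp hi
    obtain ⟨b, ⟨hbc, hb⟩, hb0⟩ := (Submodule.ne_bot_iff _).mp hj
    exact (Submodule.ne_bot_iff _).mpr ⟨a * b, ⟨mul_mem (S := Subalgebra F D) hac hbc,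
      h.gradedAlgebra.mul_mem ha hb⟩, h.mul_ne_zero_left ha ha0 hb0⟩
  neg_mem' := by
    intro i hi
    have := h.nontrivial
    obtain ⟨a, ⟨hac, ha⟩, ha0⟩ := (Submodule.ne_bot_iff _).mp hi
    obtain ⟨b, hb, hab, hba⟩ := h.exists_inv i a ha ha0
    refine (Submodule.ne_bot_iff _).mpr ⟨b, ⟨?_, hb⟩, ?_⟩
    · change b ∈ Subalgebra.center F D
      have hac' : ∀ x, x * a = a * x :=
        Subalgebra.mem_center_iff (R := F).mp hac
      rw [Subalgebra.mem_center_iff]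
      intro d
      calc d * b = b * (a * d) * b := by rw [← mul_assoc, hba, one_mul]
        _ = b * d * (a * b) := by rw [← hac' d]; simp only [mul_assoc]
        _ = b * d := by rw [hab, mul_one]
    · rintro rfl
      simp at hab

theorem centerSupp_subset (h : IsGradedDivision 𝒟) : (h.centerSupp : Set G) ⊆ support 𝒟 := by
  intro g hg
  obtain ⟨a, ⟨-, ha⟩, ha0⟩ := (Submodule.ne_bot_iff _).mp hg
  exact h.mem_supp ha ha0

theorem mem_centerSupp (h : IsGradedDivision 𝒟) {g : G} {a : D}
    (hac : a ∈ Subalgebra.center F D) (ha : a ∈ 𝒟 g) (ha0 : a ≠ 0) : g ∈ h.centerSupp :=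
  (Submodule.ne_bot_iff _).mpr ⟨a, ⟨hac, ha⟩, ha0⟩

/-- The center is graded, and a line `𝒟 g` that meets it nontrivially lies in it. The results on
parts of subgroups thus apply to the center. -/
theorem toSubmodule_center (h : IsGradedDivision 𝒟) :
    Subalgebra.toSubmodule (Subalgebra.center F D) = ⨆ z : h.centerSupp, 𝒟 z := by
  refine le_antisymm (fun c hc => ?_) (iSup_le fun z => ?_)
  · rw [← h.grading.sum_comp (v := c) (s := (h.grading.finite_comp_ne_zero c).toFinset)
      (fun g hg => by simpa using hg)]
    refine sum_mem fun g hg => ?_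
    exact Submodule.mem_iSup_of_mem (⟨g, h.mem_centerSupp (h.comp_mem_center hc g)
      (h.grading.comp_mem g c) (by simpa using hg)⟩ : h.centerSupp) (h.grading.comp_mem g c)
  · obtain ⟨a, ⟨hac, ha⟩, ha0⟩ := (Submodule.ne_bot_iff _).mp z.2
    exact h.le_center hac ha ha0

section Average

/-- The sum of the conjugates of an element by homogeneous units of all degrees. -/
noncomputable def average (h : IsGradedDivision 𝒟) [Fintype h.supp] : D →ₗ[F] D :=
  ∑ s, LinearMap.mulLeft F (((h.unit s)⁻¹ : Dˣ) : D) ∘ₗ LinearMap.mulRight F (h.unit s : D)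

theorem average_apply (h : IsGradedDivision 𝒟) [Fintype h.supp] (d : D) :
    h.average d = ∑ s, (((h.unit s)⁻¹ : Dˣ) : D) * (d * h.unit s) := by
  simp [average, LinearMap.sum_apply]

theorem average_of_mem (h : IsGradedDivision 𝒟) [Fintype h.supp] {t : G} (ht : t ∈ h.centerSupp)
    {d : D} (hd : d ∈ 𝒟 t) : h.average d = (Fintype.card h.supp : F) • d := by
  have hc : ∀ x, x * d = d * x := Subalgebra.mem_center_iff.mp
    (mem_part h.toSubmodule_center ht hd)
  rw [h.average_apply]
  simp only [← hc, Units.inv_mul_cancel_left]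
  rw [Finset.sum_const, Finset.card_univ, Nat.cast_smul_eq_nsmul]

/-- Conjugation by the unit of degree `s` multiplies `d` by a scalar `b s`. This scalar is
multiplicative in `s` and not identically one, since `d` is not central; hence its values sum to
zero. -/
theorem average_of_notMem (h : IsGradedDivision 𝒟) [Fintype h.supp] {t : G}
    (ht : t ∉ h.centerSupp) {d : D} (hd : d ∈ 𝒟 t) : h.average d = 0 := by
  by_cases hd0 : d = 0
  · simp [hd0]
  have hu0 : ∀ s, (h.unit s : D) * d ≠ 0 := fun s => by simpa using hd0
  have hb : ∀ s, ∃ b : F, d * h.unit s = b • (h.unit s * d) := fun s => by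
    have := h.nontrivial
    exact h.exists_commutator (h.unit_mem s) (h.unit s).ne_zero hd hd0
  choose b hb using hb
  have havg : h.average d = (∑ s, b s) • d := by
    rw [h.average_apply, Finset.sum_smul]
    refine Finset.sum_congr rfl fun s _ => ?_
    rw [hb, mul_smul_comm, Units.inv_mul_cancel_left]
  have hne : ∃ s, b s ≠ 1 := by
    by_contra! hc
    refine ht (h.mem_centerSupp (Subalgebra.mem_center_iff.mpr fun x => ?_) hd hd0)
    induction x using h.grading.induction with
    | mem j x hx =>
      by_cases hx0 : x = 0
      · simp [hx0]
      · have := h.nontrivial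
        obtain ⟨c, hc'⟩ := h.exists_smul j _ (h.unit_mem ⟨j, h.mem_supp hx hx0⟩)
          (h.unit _).ne_zero x hx
        rw [hc', smul_mul_assoc, mul_smul_comm, hb, hc, one_smul]
    | zero => simp
    | add x y hx hy => rw [add_mul, mul_add, hx, hy]
  obtain ⟨s₀, hs₀⟩ := hne
  have hmul : ∀ s, b (s₀ + s) = b s₀ * b s := by
    intro s
    have := h.nontrivial
    obtain ⟨c, hc⟩ := h.exists_smul (s₀ + s : G) (h.unit s₀ * h.unit s)
      (h.gradedAlgebra.mul_mem (h.unit_mem s₀) (h.unit_mem s))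
      (by rw [← Units.val_mul]; exact Units.ne_zero _) (h.unit (s₀ + s)) (h.unit_mem (s₀ + s))
    have h1 : d * h.unit (s₀ + s) = (b s₀ * b s) • (h.unit (s₀ + s) * d) := by
      calc d * h.unit (s₀ + s) = c • ((d * h.unit s₀) * h.unit s) := by
            rw [hc, mul_smul_comm, mul_assoc]
        _ = c • b s₀ • (h.unit s₀ * (d * h.unit s)) := by
            rw [hb s₀, smul_mul_assoc, mul_assoc]
        _ = (b s₀ * b s) • (h.unit (s₀ + s) * d) := by
            rw [hb s, hc, mul_smul_comm, smul_mul_assoc, mul_assoc, smul_smul, smul_smul, smul_smul]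
            congr 1
            ring
    rw [hb] at h1
    exact smul_left_injective F (hu0 (s₀ + s)) h1
  have hsum : ∑ s, b s = b s₀ * ∑ s, b s := by
    rw [Finset.mul_sum]
    simp only [← hmul]
    exact (Fintype.sum_equiv (Equiv.addLeft s₀) _ _ fun _ => rfl).symm
  have : (1 - b s₀) * ∑ s, b s = 0 := by rw [sub_mul, one_mul, ← hsum, sub_self]
  rw [havg, (mul_eq_zero.mp this).resolve_left (sub_ne_zero.mpr hs₀.symm), zero_smul]

theorem average_eq (h : IsGradedDivision 𝒟) [Fintype h.supp] (d : D) :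
    h.average d = (Fintype.card h.supp : F) • h.grading.projOn h.centerSupp d := by
  induction d using h.grading.induction with
  | mem t d hd =>
    by_cases ht : t ∈ h.centerSupp
    · rw [h.average_of_mem ht hd, h.grading.projOn_of_mem ht hd]
    · rw [h.average_of_notMem ht hd, h.grading.projOn_of_notMem ht hd, smul_zero]
  | zero => simp
  | add x y hx hy => simp only [map_add, smul_add, hx, hy]

end Average

section Center

variable [FiniteDimensional F D]

/-- Every two-sided ideal that contains a nonzero element of `D ε` contains `ε`, if `ε` belongs to
a character of the center. -/
theorem mem_of_mem_twoSided (h : IsGradedDivision 𝒟)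
    (hchar : ¬ ringChar F ∣ Module.finrank F D) {ρ : Subalgebra.center F D →ₐ[F] F}
    {ε : Subalgebra.center F D} (hε : IsCharIdempotent ρ ε) (J : Submodule F D)
    (hl : ∀ a, ∀ x ∈ J, a * x ∈ J) (hr : ∀ a, ∀ x ∈ J, x * a ∈ J) {d : D} (hdJ : d ∈ J)
    (hd : d ≠ 0) (hdε : d * ε = d) : (ε : D) ∈ J := by
  have := h.finite_of_subset (K := h.supp) subset_rfl
  have := Fintype.ofFinite h.supp
  have hcard : (Fintype.card h.supp : F) ≠ 0 := by
    rw [← Nat.card_eq_fintype_card]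
    exact h.card_ne_zero hchar (K := h.supp) subset_rfl
  obtain ⟨d', hd'⟩ := h.exists_homogeneous_mul (K := h.centerSupp) hd
  have hmem := h.projOn_mem_part h.toSubmodule_center (d' * d)
  have h1 : h.grading.projOn h.centerSupp (d' * d) = ρ ⟨_, hmem⟩ • (ε : D) := by
    conv_lhs => rw [← hdε, ← mul_assoc, h.projOn_mul_part h.toSubmodule_center]
    exact congrArg Subtype.val (hε.mul_eq ⟨_, hmem⟩)
  have hρ : ρ ⟨_, hmem⟩ ≠ 0 := fun e => hd' (by rw [h1, e, zero_smul])
  -- A two-sided ideal is stable under the sum of conjugations. This brings the central projection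
  -- of `d' d`, a nonzero multiple of `ε`, into `J`.
  have h2 : h.average (d' * d) ∈ J := by
    rw [h.average_apply]
    exact sum_mem fun s _ => hl _ _ (hr _ _ (hl _ _ hdJ))
  rw [h.average_eq, h1, smul_smul] at h2
  exact (J.smul_mem_iff (mul_ne_zero hcard hρ)).mp h2

theorem exists_center_isCharIdempotent (h : IsGradedDivision 𝒟)
    (hchar : ¬ ringChar F ∣ Module.finrank F D) (ρ : Subalgebra.center F D →ₐ[F] F) :
    ∃ ε, IsCharIdempotent ρ ε :=
  h.exists_isCharIdempotent h.centerSupp_subset h.toSubmodule_center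
    (h.card_ne_zero hchar h.centerSupp_subset) ρ

variable [IsAlgClosed F]

/-- A character with value one at `ε` has an idempotent lying under `ε`, and primitivity makes the
two equal. -/
theorem exists_isCharIdempotent_of_isPrimitiveIdempotent (h : IsGradedDivision 𝒟)
    (hchar : ¬ ringChar F ∣ Module.finrank F D) {ε : Subalgebra.center F D}
    (hε : IsPrimitiveIdempotent ε) : ∃ ρ : Subalgebra.center F D →ₐ[F] F,
      IsCharIdempotent ρ ε := by
  obtain ⟨ρ, hρ⟩ := exists_algHom_eq_one_of_isIdempotentElem (F := F) hε.idem hε.ne_zero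
  obtain ⟨η, hη⟩ := h.exists_center_isCharIdempotent hchar ρ
  have h1 : ε * η = η := by rw [hη.mul_eq, hρ, one_smul]
  have h2 : η * ε = η := by rw [mul_comm, h1]
  exact ⟨ρ, hε.eq_of_mul_eq hη.idem hη.ne_zero h1 h2 ▸ hη⟩

theorem exists_isPrimitiveIdempotent (h : IsGradedDivision 𝒟)
    (hchar : ¬ ringChar F ∣ Module.finrank F D) :
    ∃ ε : Subalgebra.center F D, IsPrimitiveIdempotent ε := by
  have := h.nontrivial
  obtain ⟨ρ, -⟩ := exists_algHom_eq_one_of_isIdempotentElem (F := F)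
    (C := Subalgebra.center F D) IsIdempotentElem.one one_ne_zero
  obtain ⟨ε, hε⟩ := h.exists_center_isCharIdempotent hchar ρ
  exact ⟨ε, hε.isPrimitiveIdempotent⟩

end Center

/-! ### Twisting by characters of the support. -/

section Twist

variable [FiniteDimensional F D]

/-- A character of the support acts on the algebra. -/
theorem exists_twistHom (h : IsGradedDivision 𝒟) (χ : Multiplicative h.supp →* Fˣ) :
    ∃ θ : D →ₐ[F] D, ∀ (t : h.supp), ∀ d ∈ 𝒟 t, θ d = (χ (.ofAdd t) : F) • d := by
  have := h.finite_of_subset (K := h.supp) subset_rfl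
  have := Fintype.ofFinite h.supp
  let θ : D →ₗ[F] D := ∑ t : h.supp, (χ (.ofAdd t) : F) • h.grading.comp (t : G)
  have hθ : ∀ (t : h.supp), ∀ d ∈ 𝒟 t, θ d = (χ (.ofAdd t) : F) • d := by
    intro t d hd
    rw [LinearMap.sum_apply, Finset.sum_eq_single_of_mem t (Finset.mem_univ _)]
    · rw [LinearMap.smul_apply, h.grading.comp_of_mem hd]
    · intro s _ hs
      rw [LinearMap.smul_apply, h.grading.comp_of_mem_ne (fun e => hs (Subtype.ext e)) hd, smul_zero]
  refine ⟨AlgHom.ofLinearMap θ ?_ fun x y => ?_, hθ⟩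
  · rw [hθ 0 1 h.gradedAlgebra.one_mem, ofAdd_zero, map_one, Units.val_one, one_smul]
  · induction x using h.grading.induction with
    | zero => simp
    | add x x' hx hx' => rw [add_mul, map_add, map_add, add_mul, hx, hx']
    | mem i x hx =>
      induction y using h.grading.induction with
      | zero => simp
      | add y y' hy hy' => rw [mul_add, map_add, map_add, mul_add, hy, hy']
      | mem j y hy =>
        by_cases hx0 : x = 0
        · simp [hx0]
        by_cases hy0 : y = 0
        · simp [hy0]
        let s : h.supp := ⟨i, h.mem_supp hx hx0⟩
        let t : h.supp := ⟨j, h.mem_supp hy hy0⟩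
        rw [hθ s x hx, hθ t y hy, hθ (s + t) (x * y) (h.gradedAlgebra.mul_mem hx hy), ofAdd_add,
          map_mul, Units.val_mul, smul_mul_smul_comm]

theorem exists_twist (h : IsGradedDivision 𝒟) (χ : Multiplicative h.supp →* Fˣ) :
    ∃ θ : D ≃ₐ[F] D, ∀ (t : h.supp), ∀ d ∈ 𝒟 t, θ d = (χ (.ofAdd t) : F) • d := by
  have hinv : ∀ (χ χ' : Multiplicative h.supp →* Fˣ) (θ θ' : D →ₐ[F] D), χ * χ' = 1 →
      (∀ (t : h.supp), ∀ d ∈ 𝒟 t, θ d = (χ (.ofAdd t) : F) • d) →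
      (∀ (t : h.supp), ∀ d ∈ 𝒟 t, θ' d = (χ' (.ofAdd t) : F) • d) →
      θ.comp θ' = AlgHom.id F D := by
    intro χ χ' θ θ' hχ hθ hθ'
    have : (θ.comp θ').toLinearMap = LinearMap.id := by
      refine h.grading.linearMap_ext fun g d hd => ?_
      by_cases hd0 : d = 0
      · simp [hd0]
      let t : h.supp := ⟨g, h.mem_supp hd hd0⟩
      have hχt := congrArg Units.val (DFunLike.congr_fun hχ (.ofAdd t))
      rw [MonoidHom.mul_apply, Units.val_mul, MonoidHom.one_apply, Units.val_one] at hχt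
      change θ (θ' d) = d
      rw [hθ' t d hd, map_smul, hθ t d hd, smul_smul, mul_comm, hχt, one_smul]
    exact AlgHom.ext fun d => LinearMap.congr_fun this d
  obtain ⟨θ, hθ⟩ := h.exists_twistHom χ
  obtain ⟨θ', hθ'⟩ := h.exists_twistHom χ⁻¹
  exact ⟨AlgEquiv.ofAlgHom θ θ' (hinv _ _ _ _ (mul_inv_cancel χ) hθ hθ')
    (hinv _ _ _ _ (inv_mul_cancel χ) hθ' hθ), hθ⟩

variable [IsAlgClosed F]

/-- The graded automorphisms permute the idempotents of the characters of the center
transitively. -/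
theorem exists_automorphism (h : IsGradedDivision 𝒟) (hchar : ¬ ringChar F ∣ Module.finrank F D)
    {ρ ρ' : Subalgebra.center F D →ₐ[F] F} {ε ε' : Subalgebra.center F D}
    (hε : IsCharIdempotent ρ ε) (hε' : IsCharIdempotent ρ' ε') :
    ∃ θ : D ≃ₐ[F] D, (∀ g, ∀ d ∈ 𝒟 g, θ d ∈ 𝒟 g) ∧ θ ε = ε' := by
  have := h.finite_of_subset (K := h.supp) subset_rfl
  have hcard : (Nat.card h.supp : F) ≠ 0 := h.card_ne_zero hchar (K := h.supp) subset_rfl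
  -- The exponent of the support is invertible in `F`, so `F` has the roots of unity needed to
  -- extend characters from the support of the center.
  have hexp : NeZero ((Monoid.exponent (Multiplicative h.supp) : ℕ) : F) := by
    refine ⟨fun e => hcard ?_⟩
    rw [ringChar.spec] at e ⊢
    exact e.trans (Group.exponent_dvd_nat_card (G := Multiplicative h.supp))
  obtain ⟨Y, hY, hρ', hone, hmul, -⟩ :=
    h.exists_multiplicative_basis h.centerSupp_subset h.toSubmodule_center ρ'
  have hY0 : ∀ z, ρ (Y z) ≠ 0 := fun z => h.algHom_ne_zero h.toSubmodule_center ρ (hY z) fun e => by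
    simpa [e] using hρ' z
  let Z : Subgroup (Multiplicative h.supp) := (h.centerSupp.addSubgroupOf h.supp).toSubgroup
  -- On elements normalized by `ρ'`, the values of `ρ` form a character of the support of the
  -- center. Twisting by an extension of it to the whole support turns `ρ'` into `ρ`.
  let ψ : Z →* Fˣ :=
    { toFun := fun z => Units.mk0 (ρ (Y ⟨(z.1.toAdd : G), z.2⟩)) (hY0 _)
      map_one' := Units.ext (by
        change ρ (Y 0) = 1
        rw [hone, map_one])
      map_mul' := fun z w => Units.ext (by
        change ρ (Y (⟨_, z.2⟩ + ⟨_, w.2⟩)) = ρ (Y _) * ρ (Y _)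
        rw [hmul, map_mul]
        rfl) }
  obtain ⟨χ, hχ⟩ := MonoidHom.domRestrict_surjective F Z ψ
  obtain ⟨θ, hθ⟩ := h.exists_twist χ
  have hθmem : ∀ g, ∀ d ∈ 𝒟 g, θ d ∈ 𝒟 g := by
    intro g d hd
    by_cases hd0 : d = 0
    · simp [hd0]
    · rw [hθ ⟨g, h.mem_supp hd hd0⟩ d hd]
      exact Submodule.smul_mem _ _ hd
  have hcen : ∀ c : Subalgebra.center F D, θ c ∈ Subalgebra.center F D := by
    intro c
    rw [Subalgebra.mem_center_iff]
    intro d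
    obtain ⟨d, rfl⟩ := θ.surjective d
    rw [← map_mul, ← map_mul, Subalgebra.mem_center_iff.mp c.2]
  have hρθ : ∀ c : Subalgebra.center F D, ρ' ⟨θ c, hcen c⟩ = ρ c := by
    let f : Subalgebra.center F D →ₗ[F] Subalgebra.center F D :=
      LinearMap.restrict (p := Subalgebra.toSubmodule (Subalgebra.center F D))
        (q := Subalgebra.toSubmodule (Subalgebra.center F D)) θ.toLinearMap fun c hc => hcen ⟨c, hc⟩
    have : ρ'.toLinearMap ∘ₗ f = ρ.toLinearMap := by
      refine part_linearMap_ext h.toSubmodule_center fun z a ha => ?_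
      have ha' := h.eq_smul_of_algHom_eq_one ρ' (hY z) (hρ' z) ha
      have hz : (z : G) ∈ h.supp := h.centerSupp_subset z.2
      have hχz : (χ (.ofAdd ⟨z, hz⟩) : F) = ρ (Y z) :=
        congrArg Units.val (DFunLike.congr_fun hχ (⟨.ofAdd ⟨z, hz⟩, z.2⟩ : Z))
      have hfa : f a = ρ (Y z) • a := Subtype.ext (by
        change θ (a : D) = ρ (Y z) • (a : D)
        rw [← hχz]
        exact hθ ⟨z, hz⟩ a ha)
      rw [LinearMap.comp_apply, hfa, map_smul, AlgHom.toLinearMap_apply, AlgHom.toLinearMap_apply]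
      conv_rhs => rw [ha', map_smul]
      rw [smul_eq_mul, smul_eq_mul, mul_comm]
    exact fun c => LinearMap.congr_fun this c
  refine ⟨θ, hθmem, ?_⟩
  -- The product of `ε'` and `θ ε` equals each factor, since `ρ' ∘ θ = ρ` on the center.
  have h1 : ε' * ⟨θ ε, hcen ε⟩ = ε' := by
    rw [hε'.mul_eq', hρθ, hε.map_eq, one_smul]
  have h2 : ∀ x : Subalgebra.center F D, ∃ y : Subalgebra.center F D, θ y = x := by
    intro x
    obtain ⟨y, hy⟩ := θ.surjective (x : D)
    refine ⟨⟨y, Subalgebra.mem_center_iff.mpr fun d => θ.injective ?_⟩, hy⟩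
    rw [map_mul, map_mul, hy, Subalgebra.mem_center_iff.mp x.2]
  obtain ⟨c, hc⟩ := h2 ε'
  have hc' : (⟨θ c, hcen c⟩ : Subalgebra.center F D) = ε' := Subtype.ext hc
  have h3 : (ε' : D) * θ ε = θ ε := by
    have h4 := congrArg Subtype.val (hε.mul_eq c)
    rw [← hρθ, hc', hε'.map_eq, one_smul] at h4
    rw [← hc, ← map_mul]
    exact congrArg θ h4
  rw [← h3]
  exact congrArg Subtype.val h1

end Twist

end IsGradedDivision

end GrMod

/-! ### The centralizer of a graded simple module and its submodules. -/

namespace GrMod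

variable {F : Type*} [Field F] {G : Type*} [AddCommGroup G]

omit [AddCommGroup G] in
theorem IsGrading.isGradedSubspace {V : Type*} [AddCommGroup V] [Module F V]
    {𝒱 : G → Submodule F V} (h : IsGrading 𝒱) {N : Submodule F V}
    (hN : ∀ g, ∀ v ∈ N, h.comp g v ∈ N) : IsGradedSubspace 𝒱 N := by
  refine le_antisymm (fun v hv => ?_) (iSup_le fun g => inf_le_left)
  rw [← h.sum_comp (v := v) (s := (h.finite_comp_ne_zero v).toFinset)
    (fun g hg => by simpa using hg)]
  exact sum_mem fun g _ => Submodule.mem_iSup_of_mem g ⟨hN g v hv, h.comp_mem g v⟩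

theorem isGradedAlgebra_endGrading {V : Type*} [AddCommGroup V] [Module F V]
    [FiniteDimensional F V] {𝒱 : G → Submodule F V} (h : IsGrading 𝒱) :
    IsGradedAlgebra (endGrading 𝒱) := by
  refine ⟨isGrading_endGrading h, { one_mem := fun k v hv => ?_, mul_mem := ?_ }⟩
  · rw [zero_add]; exact hv
  · intro i j a b ha hb k v hv
    rw [add_assoc]
    exact ha _ _ (hb _ _ hv)

variable {R : Type*} [Ring R] [Algebra F R] {ℛ : G → Submodule F R}
  {W : Type*} [AddCommGroup W] [Module F W] [Module R W] [IsScalarTower F R W]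
  {𝒲 : G → Submodule F W}

theorem lsmul_mem_endGrading (h : IsGradedModule ℛ 𝒲) {g : G} {r : R} (hr : r ∈ ℛ g) :
    Algebra.lsmul F F W r ∈ endGrading 𝒲 g := fun _ _ hv => h.smul_mem hr hv

theorem IsGradedModule.comp_smul (h : IsGradedModule ℛ 𝒲) {k : G} {r : R} (hr : r ∈ ℛ k) (g : G)
    (w : W) : h.grading.comp (k + g) (r • w) = r • h.grading.comp g w := by
  have : h.grading.comp (k + g) ∘ₗ Algebra.lsmul F F W r
      = Algebra.lsmul F F W r ∘ₗ h.grading.comp g := by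
    refine h.grading.linearMap_ext fun j x hx => ?_
    simp only [LinearMap.comp_apply, Algebra.lsmul_coe]
    by_cases hg : g = j
    · subst hg
      rw [h.grading.comp_of_mem hx, h.grading.comp_of_mem (h.smul_mem hr hx)]
    · rw [h.grading.comp_of_mem_ne hg hx,
        h.grading.comp_of_mem_ne (fun e => hg (add_left_cancel e)) (h.smul_mem hr hx), smul_zero]
  exact LinearMap.congr_fun this w

theorem IsGradedModule.comp_smul_of_mem (hℛ : IsGrading ℛ) (h : IsGradedModule ℛ 𝒲) {g : G}
    {w : W} (hw : w ∈ 𝒲 g) (k : G) (r : R) :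
    h.grading.comp (k + g) (r • w) = hℛ.comp k r • w := by
  induction r using hℛ.induction with
  | mem j r hr =>
    by_cases hj : k = j
    · subst hj
      rw [hℛ.comp_of_mem hr, h.comp_smul hr, h.grading.comp_of_mem hw]
    · rw [hℛ.comp_of_mem_ne hj hr, zero_smul, h.grading.comp_of_mem_ne (fun e => hj
        (add_right_cancel e)) (h.smul_mem hr hw)]
  | zero => simp
  | add x y hx hy => rw [add_smul, map_add, hx, hy, map_add, add_smul]

theorem IsGradedModule.induced {K : Type*} [AddCommGroup K] (α : G →+ K)
    (h : IsGradedModule ℛ 𝒲) : IsGradedModule (induced α ℛ) (induced α 𝒲) := by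
  refine ⟨h.grading.induced α, ⟨fun {i j r w} hr hw => ?_⟩⟩
  refine map_iSup_induced α (f := Algebra.lsmul F F W r) (fun g hg w hw => ?_) hw
  refine map_iSup_induced α (f := (LinearMap.applyₗ w) ∘ₗ (Algebra.lsmul F F W).toLinearMap)
    (fun g' hg' r hr => ?_) hr
  rw [← hg, ← hg', vadd_eq_add, ← map_add]
  exact mem_induced α (h.smul_mem hr hw)

section Centralizer

theorem comp_centralizer (h : IsGradedModule ℛ 𝒲) {k : G} {c : Centralizer R W}
    (hc : c ∈ centGrading R 𝒲 k) (g : G) (w : W) :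
    h.grading.comp (k + g) (c.unop w) = c.unop (h.grading.comp g w) := by
  have : h.grading.comp (k + g) ∘ₗ c.unop.restrictScalars F
      = c.unop.restrictScalars F ∘ₗ h.grading.comp g := by
    refine h.grading.linearMap_ext fun j x hx => ?_
    simp only [LinearMap.comp_apply, LinearMap.restrictScalars_apply]
    by_cases hg : g = j
    · subst hg
      rw [h.grading.comp_of_mem hx, h.grading.comp_of_mem (hc _ _ hx)]
    · rw [h.grading.comp_of_mem_ne hg hx,
        h.grading.comp_of_mem_ne (fun e => hg (add_left_cancel e)) (hc _ _ hx), map_zero]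
  exact LinearMap.congr_fun this w

variable [FiniteDimensional F W]

/-- The point is that the components of `c` in `End_F(W)` are again `R`-linear: commutation with a
homogeneous `r` holds degree by degree, because `G` is abelian. -/
theorem isGradedAlgebra_centGrading (hℛ : IsGrading ℛ) (h : IsGradedModule ℛ 𝒲) :
    IsGradedAlgebra (centGrading R 𝒲) := by
  refine ⟨isGrading_iff.mpr ⟨?_, ?_⟩, { one_mem := fun k w hw => ?_, mul_mem := ?_ }⟩
  · rw [iSupIndep_iff_finsetSum_eq_zero_imp_eq_zero]
    intro s c hc hsum i hi
    have h1 := (iSupIndep_iff_finsetSum_eq_zero_imp_eq_zero _).mp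
      (iSupIndep_endGrading h.grading) s (fun i => (c i).unop.restrictScalars F)
      (fun i hi => hc i hi) (by
        ext w
        have := congrArg (fun c : Centralizer R W => c.unop w) hsum
        simpa [LinearMap.sum_apply] using this) i hi
    exact MulOpposite.unop_injective (LinearMap.ext fun w => LinearMap.congr_fun h1 w)
  · refine eq_top_iff.mpr fun c _ => ?_
    have hE := isGradedAlgebra_endGrading h.grading
    let f : Module.End F W := c.unop.restrictScalars F
    have hcomm : ∀ (g : G) (r : R) (w : W), hE.grading.comp g f (r • w)
        = r • hE.grading.comp g f w := by
      intro g r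
      induction r using hℛ.induction with
      | mem k r hr =>
        have h1 := hE.comp_mul_left (lsmul_mem_endGrading h hr) g f
        have h2 := hE.comp_mul_right (lsmul_mem_endGrading h hr) g f
        have h3 : Algebra.lsmul F F W r * f = f * Algebra.lsmul F F W r :=
          LinearMap.ext fun w => (c.unop.map_smul r w).symm
        rw [h3, h2] at h1
        exact LinearMap.congr_fun h1
      | zero => simp
      | add r r' hr hr' =>
        intro w
        rw [add_smul, map_add, hr, hr', add_smul]
    let d : G → Centralizer R W := fun g => MulOpposite.op
      { toFun := hE.grading.comp g f
        map_add' := map_add _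
        map_smul' := hcomm g }
    have hd : c = ∑ g ∈ (hE.grading.finite_comp_ne_zero f).toFinset, d g := by
      refine MulOpposite.unop_injective (LinearMap.ext fun w => ?_)
      have := hE.grading.sum_comp (v := f) (s := (hE.grading.finite_comp_ne_zero f).toFinset)
        (fun g hg => by simpa using hg)
      have := LinearMap.congr_fun this w
      rw [LinearMap.sum_apply] at this
      rw [Finset.unop_sum, LinearMap.sum_apply]
      exact this.symm
    rw [hd]
    exact sum_mem fun g _ => Submodule.mem_iSup_of_mem g
      fun k w hw => hE.grading.comp_mem g f k w hw
  · rw [zero_add]; exact hw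
  · intro i j a b ha hb k w hw
    rw [add_comm i j, add_assoc]
    exact hb _ _ (ha _ _ hw)

/-- The kernel of a homogeneous endomorphism is a graded submodule, hence zero. Finite dimension
then gives surjectivity. -/
theorem bijective_of_mem_centGrading (h : IsGradedModule ℛ 𝒲) (hs : IsGradedSimple R 𝒲) {g : G}
    {c : Centralizer R W} (hc : c ∈ centGrading R 𝒲 g) (hc0 : c ≠ 0) :
    Function.Bijective c.unop := by
  have hinj : Function.Injective c.unop := by
    rw [← LinearMap.ker_eq_bot]
    refine (hs.2 (LinearMap.ker c.unop) (h.grading.isGradedSubspace fun k w hw => ?_)).resolve_right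
      fun e => hc0 ?_
    · change c.unop (h.grading.comp k w) = 0
      rw [← comp_centralizer h hc, show c.unop w = 0 from hw, map_zero]
    · exact MulOpposite.unop_injective (LinearMap.ker_eq_top.mp e)
  exact ⟨hinj, LinearMap.surjective_of_injective (f := c.unop.restrictScalars F) hinj⟩

theorem isGradedDivision_centGrading [IsAlgClosed F] (hℛ : IsGrading ℛ) (h : IsGradedModule ℛ 𝒲)
    (hs : IsGradedSimple R 𝒲) : IsGradedDivision (centGrading R 𝒲) := by
  have hA := isGradedAlgebra_centGrading hℛ h
  have hW := hs.1
  have hinv : ∀ g, ∀ a ∈ centGrading R 𝒲 g, a ≠ 0 →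
      ∃ b ∈ centGrading R 𝒲 (-g), a * b = 1 ∧ b * a = 1 := by
    intro g a ha ha0
    let e := LinearEquiv.ofBijective a.unop (bijective_of_mem_centGrading h hs ha ha0)
    refine ⟨MulOpposite.op e.symm.toLinearMap, fun k w hw => ?_,
      MulOpposite.unop_injective (LinearMap.ext fun w => e.symm_apply_apply w),
      MulOpposite.unop_injective (LinearMap.ext fun w => e.apply_symm_apply w)⟩
    change e.symm w ∈ _
    have h1 := comp_centralizer h ha (-g + k) (e.symm w)
    rw [add_neg_cancel_left, show a.unop (e.symm w) = w from e.apply_symm_apply w,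
      h.grading.comp_of_mem hw] at h1
    have h2 : e.symm w = h.grading.comp (-g + k) (e.symm w) :=
      e.injective ((e.apply_symm_apply w).trans h1)
    rw [h2]
    exact h.grading.comp_mem _ _
  -- For an eigenvalue `r` the difference `c - r` is homogeneous of degree zero and not injective,
  -- hence zero. Other components reduce to this one by multiplying with an inverse.
  have hscal : ∀ c ∈ centGrading R 𝒲 0, ∃ r : F, c = r • 1 := by
    intro c hc
    obtain ⟨r, hr⟩ := Module.End.exists_eigenvalue (c.unop.restrictScalars F : Module.End F W)
    obtain ⟨w, hw, hw0⟩ := hr.exists_hasEigenvector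
    rw [Module.End.mem_eigenspace_iff] at hw
    refine ⟨r, ?_⟩
    by_contra hne
    have hmem : c - r • 1 ∈ centGrading R 𝒲 0 :=
      sub_mem hc (Submodule.smul_mem _ _ hA.one_mem)
    refine hw0 ((bijective_of_mem_centGrading h hs hmem (sub_ne_zero.mpr hne)).1 ?_)
    have hw' : c.unop w = r • w := hw
    simp [hw']
  refine ⟨hA, ?_, hinv, fun g a ha ha0 b hb => ?_⟩
  · obtain ⟨w, hw⟩ := exists_ne (0 : W)
    refine ⟨⟨1, 0, fun e => hw ?_⟩⟩
    exact congrArg (fun c : Centralizer R W => c.unop w) e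
  · obtain ⟨a', ha', -, ha'a⟩ := hinv g a ha ha0
    obtain ⟨r, hr⟩ := hscal (b * a') (by
      have := hA.mul_mem hb ha'
      rwa [add_neg_cancel] at this)
    refine ⟨r, ?_⟩
    rw [← mul_one b, ← ha'a, ← mul_assoc, hr, smul_mul_assoc, one_mul]

theorem finiteDimensional_linearMap {V : Type*} [AddCommGroup V] [Module F V] [Module R V]
    [IsScalarTower F R V] [FiniteDimensional F V] : FiniteDimensional F (V →ₗ[R] W) := by
  let f : (V →ₗ[R] W) →ₗ[F] (V →ₗ[F] W) :=
    { toFun := fun c => c.restrictScalars F, map_add' := fun _ _ => rfl, map_smul' := fun _ _ => rfl }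
  exact FiniteDimensional.of_injective f fun a b hab =>
    LinearMap.ext fun w => LinearMap.congr_fun hab w

theorem finiteDimensional_centralizer : FiniteDimensional F (Centralizer R W) := by
  have : FiniteDimensional F (Module.End R W) := finiteDimensional_linearMap
  exact Module.Finite.equiv (MulOpposite.opLinearEquiv F)

end Centralizer

/-- Every nonzero submodule of a graded simple module `W` contains a submodule `W d` with `d ≠ 0`
in the centralizer. -/
theorem exists_range_le (hℛ : IsGrading ℛ) (h : IsGradedModule ℛ 𝒲) (hs : IsGradedSimple R 𝒲)
    {N : Submodule R W} (hN : N ≠ ⊥) :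
    ∃ d : Centralizer R W, d ≠ 0 ∧ LinearMap.range d.unop ≤ N := by
  classical
  let supp : W → Finset G := fun w => (h.grading.finite_comp_ne_zero w).toFinset
  have hsupp : ∀ w g, g ∈ supp w ↔ h.grading.comp g w ≠ 0 := fun w g => by simp [supp]
  -- Take a nonzero element of `N` with the fewest homogeneous components.
  obtain ⟨n, ⟨hnN, hn0⟩, hmin⟩ := (measure fun w => (supp w).card).wf.has_min
    {w | w ∈ N ∧ w ≠ 0} ((Submodule.ne_bot_iff N).mp hN)
  obtain ⟨g, hg⟩ := h.grading.exists_comp_ne_zero hn0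
  set m := h.grading.comp g n with hm
  have hmg : m ∈ 𝒲 g := h.grading.comp_mem g n
  -- If `r` kills the component `m`, then `r • n` lies in `N` and has fewer components than `n`, so
  -- it vanishes.
  have hann : ∀ k, ∀ r ∈ ℛ k, r • m = 0 → r • n = 0 := by
    intro k r hr hrm
    by_contra hrn
    refine hmin (r • n) ⟨N.smul_mem r hnN, hrn⟩ ?_
    change (supp (r • n)).card < (supp n).card
    have hsub : supp (r • n) ⊆ ((supp n).erase g).map (addLeftEmbedding k) := by
      intro j hj
      rw [hsupp, ← add_sub_cancel k j, h.comp_smul hr] at hj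
      refine Finset.mem_map.mpr ⟨j - k, Finset.mem_erase.mpr ⟨?_, ?_⟩, by simp⟩
      · intro e
        rw [e] at hj
        exact hj hrm
      · rw [hsupp]
        intro e
        rw [e, smul_zero] at hj
        exact hj rfl
    refine (Finset.card_le_card hsub).trans_lt ?_
    rw [Finset.card_map]
    exact Finset.card_erase_lt_of_mem ((hsupp n g).mpr hg)
  -- Since `m` is homogeneous, an element killing it has all its components killing it.
  have hann' : ∀ r : R, r • m = 0 → r • n = 0 := by
    intro r hrm
    rw [← hℛ.sum_comp (v := r) (s := (hℛ.finite_comp_ne_zero r).toFinset)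
      (fun g hg => by simpa using hg), Finset.sum_smul]
    refine Finset.sum_eq_zero fun k _ => hann k _ (hℛ.comp_mem k r) ?_
    rw [← h.comp_smul_of_mem hℛ hmg, hrm, map_zero]
  have hspan : LinearMap.range (LinearMap.toSpanSingleton R W m) = ⊤ := by
    refine (hs.2 _ (h.grading.isGradedSubspace ?_)).resolve_left fun e => hg ?_
    · rintro j _ ⟨r, rfl⟩
      refine ⟨hℛ.comp (j - g) r, ?_⟩
      rw [LinearMap.toSpanSingleton_apply, LinearMap.toSpanSingleton_apply,
        ← h.comp_smul_of_mem hℛ hmg, sub_add_cancel]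
    · exact (LinearMap.toSpanSingleton_eq_zero_iff R W).mp (LinearMap.range_eq_bot.mp e)
  let φ := LinearMap.toSpanSingleton R W m
  -- As `W = R m` and the annihilator of `m` kills `n`, the rule `r m ↦ r n` defines an endomorphism
  -- with image in `N`.
  let d : W →ₗ[R] W := (LinearMap.ker φ).liftQ (LinearMap.toSpanSingleton R W n)
    (fun r hr => hann' r hr) ∘ₗ
      (φ.quotKerEquivOfSurjective (LinearMap.range_eq_top.mp hspan)).symm.toLinearMap
  have hd : ∀ r : R, d (r • m) = r • n := by
    intro r
    have : (φ.quotKerEquivOfSurjective (LinearMap.range_eq_top.mp hspan)).symm (r • m)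
        = (LinearMap.ker φ).mkQ r := by
      rw [LinearEquiv.symm_apply_eq]
      rfl
    change (LinearMap.ker φ).liftQ (LinearMap.toSpanSingleton R W n) (fun r hr => hann' r hr)
      ((φ.quotKerEquivOfSurjective (LinearMap.range_eq_top.mp hspan)).symm (r • m)) = _
    rw [this]
    rfl
  refine ⟨MulOpposite.op d, fun e => hn0 ?_, ?_⟩
  · have h1 := hd 1
    rw [show d = 0 from congrArg MulOpposite.unop e] at h1
    simpa using h1.symm
  · rintro _ ⟨w, rfl⟩
    obtain ⟨r, rfl⟩ := LinearMap.range_eq_top.mp hspan w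
    change d (r • m) ∈ N
    rw [hd]
    exact N.smul_mem r hnN

/-- A simple submodule maps isomorphically to an eigenspace of a commutative subalgebra of the
centralizer. -/
theorem exists_eigenembedding [IsAlgClosed F] [FiniteDimensional F W]
    {𝓕 : Subalgebra F (Centralizer R W)} (hcomm : ∀ a b : 𝓕, a * b = b * a)
    (V : Submodule R W) [IsSimpleModule R V] :
    ∃ (ρ : 𝓕 →ₐ[F] F) (f : V →ₗ[R] W), Function.Injective f ∧
      ∀ (c : 𝓕) (v : V), (c : Centralizer R W).unop (f v) = ρ c • f v := by
  have hVn : Nontrivial V := IsSimpleModule.nontrivial R V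
  have hVf : FiniteDimensional F V :=
    FiniteDimensional.of_injective (V.subtype.restrictScalars F) Subtype.val_injective
  have : FiniteDimensional F (V →ₗ[R] W) := finiteDimensional_linearMap
  have : Nontrivial (V →ₗ[R] W) := by
    obtain ⟨v, hv⟩ := exists_ne (0 : V)
    refine ⟨⟨V.subtype, 0, fun e => hv (Subtype.ext ?_)⟩⟩
    exact LinearMap.congr_fun e v
  -- Postcomposition reverses products in the opposite algebra; commutativity of `𝓕` makes it an
  -- action nevertheless.
  let Φ : 𝓕 →ₐ[F] Module.End F (V →ₗ[R] W) := AlgHom.ofLinearMap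
    { toFun := fun c =>
        { toFun := fun f => (c : Centralizer R W).unop ∘ₗ f
          map_add' := fun f f' => LinearMap.comp_add _ _ _
          map_smul' := fun r f => LinearMap.ext fun v =>
            LinearMap.map_smul_of_tower _ r (f v) }
      map_add' := fun _ _ => rfl
      map_smul' := fun _ _ => rfl } rfl
    (fun a b => by
      rw [hcomm a b]
      rfl)
  let : Module 𝓕 (V →ₗ[R] W) := Module.compHom _ Φ.toRingHom
  have : IsScalarTower F 𝓕 (V →ₗ[R] W) := ⟨fun r c f => by
    change Φ (r • c) f = r • Φ c f
    rw [map_smul]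
    rfl⟩
  obtain ⟨ρ, f, hf0, hf⟩ := exists_common_eigenvector (F := F) (C := 𝓕) (X := V →ₗ[R] W) hcomm
  exact ⟨ρ, f, f.injective_or_eq_zero.resolve_right hf0, fun c v => LinearMap.congr_fun (hf c) v⟩

end GrMod

/-! ### Simple submodules: central images and the grading of `End(V)`. -/

namespace GrMod

variable {F : Type*} [Field F]

/-- Burnside's theorem. -/
theorem lsmul_surjective [IsAlgClosed F] {A M : Type*} [Ring A] [Algebra F A] [AddCommGroup M]
    [Module F M] [Module A M] [IsScalarTower F A M] [FiniteDimensional F M] [IsSimpleModule A M] :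
    Function.Surjective (Algebra.lsmul F F M : A →ₐ[F] Module.End F M) := by
  intro f
  -- Endomorphisms of the simple module `M` are scalars, so every linear map commutes with them and
  -- the density theorem applies.
  let f' : Module.End (Module.End A M) M :=
    { toFun := f
      map_add' := map_add f
      map_smul' := fun φ m => by
        obtain ⟨r, rfl⟩ := (IsSimpleModule.algebraMap_end_bijective_of_isAlgClosed F
          (A := A) (V := M)).2 φ
        simp }
  obtain ⟨s, hs⟩ := Module.Finite.fg_top (R := F) (M := M)
  obtain ⟨r, hr⟩ := jacobson_density f' s
  refine ⟨r, LinearMap.ext_on hs fun m hm => ?_⟩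
  exact (hr m hm).symm

variable {G : Type*} [AddCommGroup G] {R : Type*} [Ring R] [Algebra F R] {ℛ : G → Submodule F R}
  {W : Type*} [AddCommGroup W] [Module F W] [Module R W] [IsScalarTower F R W]
  {𝒲 : G → Submodule F W}

theorem centralizer_mem_induced {H : AddSubgroup G} {c : Centralizer R W}
    (hc : c ∈ ⨆ k : H, centGrading R 𝒲 k) {k : G ⧸ H} {w : W}
    (hw : w ∈ induced (QuotientAddGroup.mk' H) 𝒲 k) :
    c.unop w ∈ induced (QuotientAddGroup.mk' H) 𝒲 k := by
  induction hc using Submodule.iSup_induction' with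
  | mem t c hc =>
    refine map_iSup_induced _ (f := c.unop.restrictScalars F) (fun g hg w hw => ?_) hw
    rw [← hg, ← zero_add ((QuotientAddGroup.mk' H) g),
      ← show (QuotientAddGroup.mk' H) (t : G) = 0 from (QuotientAddGroup.eq_zero_iff _).mpr t.2,
      ← map_add]
    exact mem_induced _ (hc g w hw)
  | zero => exact zero_mem _
  | add x y _ _ hx hy => exact add_mem hx hy

theorem induced_centGrading_apply_mem {K : Type*} [AddCommGroup K] {α : G →+ K} {k l : K}
    {c : Centralizer R W} (hc : c ∈ induced α (centGrading R 𝒲) k) {w : W}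
    (hw : w ∈ induced α 𝒲 l) : c.unop w ∈ induced α 𝒲 (k + l) := by
  refine map_iSup_induced α (f := c.unop.restrictScalars F) (fun g hg w hw => ?_) hw
  let ev : Centralizer R W →ₗ[F] W :=
    { toFun := fun c => c.unop w, map_add' := fun _ _ => rfl, map_smul' := fun _ _ => rfl }
  refine map_iSup_induced α (f := ev) (fun g' hg' c hc => ?_) hc
  rw [← hg, ← hg', ← map_add]
  exact mem_induced α (hc g w hw)

theorem apply_eq_self_of_mem_range {ε : Centralizer R W} (hε : IsIdempotentElem ε) {w : W}
    (hw : w ∈ LinearMap.range ε.unop) : ε.unop w = w := by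
  obtain ⟨x, rfl⟩ := hw
  exact congrArg (fun c : Centralizer R W => c.unop x) hε

theorem mul_eq_self_of_range_le {ε d : Centralizer R W} (hε : IsIdempotentElem ε)
    (hd : LinearMap.range d.unop ≤ LinearMap.range ε.unop) : d * ε = d :=
  MulOpposite.unop_injective (LinearMap.ext fun w =>
    apply_eq_self_of_mem_range hε (hd (LinearMap.mem_range_self _ w)))

theorem IsCharIdempotent.coe_idem {D : Type*} [Ring D] [Algebra F D] {𝓕 : Subalgebra F D}
    {ρ : 𝓕 →ₐ[F] F} {ε : 𝓕} (hε : IsCharIdempotent ρ ε) : IsIdempotentElem (ε : D) :=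
  congrArg Subtype.val hε.idem

theorem range_le_of_eigen {𝓕 : Subalgebra F (Centralizer R W)} {ρ : 𝓕 →ₐ[F] F} {ε : 𝓕}
    (hε : IsCharIdempotent ρ ε) {V : Type*} [AddCommGroup V] [Module R V] {f : V →ₗ[R] W}
    (hf : ∀ (c : 𝓕) (v : V), (c : Centralizer R W).unop (f v) = ρ c • f v) :
    LinearMap.range f ≤ LinearMap.range (ε : Centralizer R W).unop := by
  rintro _ ⟨v, rfl⟩
  exact ⟨f v, by rw [hf, hε.map_eq, one_smul]⟩

section CentralImage

variable [IsAlgClosed F] [FiniteDimensional F W] {H : AddSubgroup G}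
  {𝓕 : Subalgebra F (Centralizer R W)}

/-- This is the simplicity of `W ε`: a nonzero `N` inside it contains some `W d` with `d = d ε ≠ 0`,
and `ε` is a left multiple of `d`. -/
theorem range_charIdempotent_le (hℛ : IsGrading ℛ) (h : IsGradedModule ℛ 𝒲)
    (hs : IsGradedSimple R 𝒲)
    (hmax : Maximal (fun K : AddSubgroup G => (K : Set G) ⊆ support (centGrading R 𝒲) ∧
      ∀ a ∈ ⨆ k : K, centGrading R 𝒲 k, ∀ b ∈ ⨆ k : K, centGrading R 𝒲 k, a * b = b * a) H)
    (h𝓕 : Subalgebra.toSubmodule 𝓕 = ⨆ k : H, centGrading R 𝒲 k) {ρ : 𝓕 →ₐ[F] F} {ε : 𝓕}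
    (hε : IsCharIdempotent ρ ε) {N : Submodule R W} (hN : N ≠ ⊥)
    (hNε : N ≤ LinearMap.range (ε : Centralizer R W).unop) :
    LinearMap.range (ε : Centralizer R W).unop ≤ N := by
  obtain ⟨d, hd0, hdN⟩ := exists_range_le hℛ h hs hN
  obtain ⟨d', hd'⟩ := (isGradedDivision_centGrading hℛ h hs).exists_corner_mul_eq hmax h𝓕 hε hd0
    (mul_eq_self_of_range_le hε.coe_idem (hdN.trans hNε))
  rintro _ ⟨w, rfl⟩
  rw [← hd']
  exact hdN (LinearMap.mem_range_self _ _)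

theorem exists_isCentralImage (hℛ : IsGrading ℛ) (h : IsGradedModule ℛ 𝒲)
    (hs : IsGradedSimple R 𝒲)
    (hchar : ¬ ringChar F ∣ Module.finrank F (Centralizer R W))
    (V : Submodule R W) [IsSimpleModule R V]
    (hmax : Maximal (fun K : AddSubgroup G => (K : Set G) ⊆ support (centGrading R 𝒲) ∧
      ∀ a ∈ ⨆ k : K, centGrading R 𝒲 k, ∀ b ∈ ⨆ k : K, centGrading R 𝒲 k, a * b = b * a) H)
    (h𝓕 : Subalgebra.toSubmodule 𝓕 = ⨆ k : H, centGrading R 𝒲 k) :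
    ∃ 𝒱 : G ⧸ H → Submodule F V, IsCentralImage ℛ 𝒲 H 𝓕 𝒱 := by
  have : FiniteDimensional F (Centralizer R W) := finiteDimensional_centralizer
  have hD := isGradedDivision_centGrading hℛ h hs
  have hcomm : ∀ a b : 𝓕, a * b = b * a := fun a b => Subtype.ext
    (hmax.prop.2 a (h𝓕 ▸ a.2) b (h𝓕 ▸ b.2))
  obtain ⟨ρ, f, hfinj, hf⟩ := exists_eigenembedding hcomm V
  obtain ⟨ε, hε⟩ := hD.exists_isCharIdempotent hmax.prop.1 h𝓕 (hD.card_ne_zero hchar hmax.prop.1) ρ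
  have hV : Nontrivial V := IsSimpleModule.nontrivial R V
  have hf0 : LinearMap.range f ≠ ⊥ := by
    obtain ⟨v, hv⟩ := exists_ne (0 : V)
    rw [Ne, LinearMap.range_eq_bot]
    rintro rfl
    exact hv (hfinj rfl)
  have hrange := range_charIdempotent_le hℛ h hs hmax h𝓕 hε hf0 (range_le_of_eigen hε hf)
  -- By simplicity of `W ε` the embedding `f` maps `V` onto it, so `γ` can be `ε` followed by the
  -- inverse of `f`.
  let γ : W →ₗ[R] V := (LinearEquiv.ofInjective f hfinj).symm.toLinearMap ∘ₗ
    LinearMap.codRestrict (LinearMap.range f) (ε : Centralizer R W).unop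
      fun w => hrange (LinearMap.mem_range_self _ w)
  have hγ : ∀ w, f (γ w) = (ε : Centralizer R W).unop w := fun w =>
    congrArg Subtype.val ((LinearEquiv.ofInjective f hfinj).apply_symm_apply
      (LinearMap.codRestrict (LinearMap.range f) (ε : Centralizer R W).unop
      (fun w => hrange (LinearMap.mem_range_self _ w)) w))
  have hγsurj : Function.Surjective γ := fun v =>
    ⟨f v, hfinj (by rw [hγ, hf, hε.map_eq, one_smul])⟩
  have hεmem : (ε : Centralizer R W) ∈ ⨆ k : H, centGrading R 𝒲 k := h𝓕 ▸ ε.2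
  -- The maps `γ` and `ε` have the same kernel, and `ε` preserves degrees modulo `H`; this yields
  -- independence of the images.
  have hgr : IsGrading fun k =>
      (induced (QuotientAddGroup.mk' H) 𝒲 k).map (γ.restrictScalars F) := by
    refine (h.grading.induced _).map (f := γ.restrictScalars F) hγsurj
      (g := (ε : Centralizer R W).unop.restrictScalars F) (fun w => ?_)
      (h.grading.induced (QuotientAddGroup.mk' H)).iSupIndep fun k w hw =>
        centralizer_mem_induced hεmem hw
    change γ w = 0 ↔ (ε : Centralizer R W).unop w = 0
    rw [← hγ, map_eq_zero_iff f hfinj]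
  refine ⟨_, ⟨h, hs, hD.maximal_isGradedSubfield hmax h𝓕,
    hD.exists_groupAlgebra_equiv hmax.prop.1 h𝓕 ρ⟩, ⟨hgr, ⟨?_⟩⟩, ρ, γ, hγsurj, fun c w => ?_,
    fun g w hw => ⟨w, mem_induced (QuotientAddGroup.mk' H) hw, rfl⟩⟩
  · rintro i j r _ hr ⟨w, hw, rfl⟩
    exact ⟨r • w, (h.induced _).smul_mem hr hw, γ.map_smul r w⟩
  · refine hfinj ?_
    rw [LinearMap.map_smul_of_tower, hγ, hγ]
    exact congrArg (fun c : Centralizer R W => c.unop w) (congrArg Subtype.val (hε.mul_eq c))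

end CentralImage

section RepGrading

variable [IsAlgClosed F] [FiniteDimensional F W]
  {ρ : Subalgebra.center F (Centralizer R W) →ₐ[F] F}
  {ε : Subalgebra.center F (Centralizer R W)}

/-- No proper nonzero submodule of `W ε` is stable under `C(W)`: the elements `c` with `W c ⊆ N`
form a two-sided ideal that meets `D ε`, hence contains `ε`. -/
theorem range_le_of_bimodule (hℛ : IsGrading ℛ) (h : IsGradedModule ℛ 𝒲)
    (hs : IsGradedSimple R 𝒲) (hchar : ¬ ringChar F ∣ Module.finrank F (Centralizer R W))
    (hε : IsCharIdempotent ρ ε) {N : Submodule R W} (hN : N ≠ ⊥)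
    (hNε : N ≤ LinearMap.range (ε : Centralizer R W).unop)
    (hND : ∀ c : Centralizer R W, ∀ w ∈ N, c.unop w ∈ N) :
    LinearMap.range (ε : Centralizer R W).unop ≤ N := by
  have : FiniteDimensional F (Centralizer R W) := finiteDimensional_centralizer
  obtain ⟨d, hd0, hdN⟩ := exists_range_le hℛ h hs hN
  let J : Submodule F (Centralizer R W) :=
    { carrier := {c | ∀ w, c.unop w ∈ N}
      add_mem' := fun ha hb w => N.add_mem (ha w) (hb w)
      zero_mem' := fun w => N.zero_mem
      smul_mem' := fun r c hc w => (N.restrictScalars F).smul_mem r (hc w) }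
  have hεJ : (ε : Centralizer R W) ∈ J :=
    (isGradedDivision_centGrading hℛ h hs).mem_of_mem_twoSided hchar hε J
      (fun a x hx w => hx _) (fun a x hx w => hND a _ (hx w))
      (d := d) (fun w => hdN (LinearMap.mem_range_self _ w)) hd0
      (mul_eq_self_of_range_le hε.coe_idem (hdN.trans hNε))
  rintro _ ⟨w, rfl⟩
  exact hεJ w

/-- The elements `c` with `r W c = 0` form a two-sided ideal containing a nonzero element of `D ε`,
hence `ε`. -/
theorem smul_range_eq_zero (hℛ : IsGrading ℛ) (h : IsGradedModule ℛ 𝒲)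
    (hs : IsGradedSimple R 𝒲) (hchar : ¬ ringChar F ∣ Module.finrank F (Centralizer R W))
    (hε : IsCharIdempotent ρ ε) {N : Submodule R W} (hN : N ≠ ⊥)
    (hNε : N ≤ LinearMap.range (ε : Centralizer R W).unop) {r : R} (hr : ∀ w ∈ N, r • w = 0)
    (w : W) : r • (ε : Centralizer R W).unop w = 0 := by
  have : FiniteDimensional F (Centralizer R W) := finiteDimensional_centralizer
  obtain ⟨d, hd0, hdN⟩ := exists_range_le hℛ h hs hN
  let J : Submodule F (Centralizer R W) :=
    { carrier := {c | ∀ w, r • c.unop w = 0}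
      add_mem' := fun {a b} ha hb w => by
        rw [MulOpposite.unop_add, LinearMap.add_apply, smul_add, ha, hb, add_zero]
      zero_mem' := fun w => smul_zero r
      smul_mem' := fun a c hc w => by
        have : r • a • c.unop w = a • r • c.unop w :=
          (Algebra.lsmul F F W r).map_smul a (c.unop w)
        exact this.trans (by rw [hc, smul_zero]) }
  exact (isGradedDivision_centGrading hℛ h hs).mem_of_mem_twoSided hchar hε J
      (fun a x hx w => hx _) (fun a x hx w => by
        change r • a.unop (x.unop w) = 0
        rw [← LinearMap.map_smul, hx, map_zero])
      (d := d) (fun w => hr _ (hdN (LinearMap.mem_range_self _ w))) hd0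
      (mul_eq_self_of_range_le hε.coe_idem (hdN.trans hNε)) w

/-- The annihilator of a simple submodule is that of its homogeneous component `W ε`. -/
theorem smul_eq_zero_iff (hℛ : IsGrading ℛ) (h : IsGradedModule ℛ 𝒲)
    (hs : IsGradedSimple R 𝒲) (hchar : ¬ ringChar F ∣ Module.finrank F (Centralizer R W))
    (hε : IsCharIdempotent ρ ε) {V : Type*} [AddCommGroup V] [Module R V] [Nontrivial V]
    {f : V →ₗ[R] W} (hfinj : Function.Injective f)
    (hf : ∀ (c : Subalgebra.center F (Centralizer R W)) (v : V),
      (c : Centralizer R W).unop (f v) = ρ c • f v) (r : R) :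
    (∀ v : V, r • v = 0) ↔ ∀ w, r • (ε : Centralizer R W).unop w = 0 := by
  constructor
  · intro hr
    refine smul_range_eq_zero hℛ h hs hchar hε (N := LinearMap.range f) ?_
      (range_le_of_eigen hε hf) ?_
    · obtain ⟨v, hv⟩ := exists_ne (0 : V)
      rw [Ne, LinearMap.range_eq_bot]
      rintro rfl
      exact hv (hfinj rfl)
    · rintro _ ⟨v, rfl⟩
      rw [← map_smul, hr, map_zero]
  · intro hr v
    refine hfinj ?_
    rw [map_smul, map_zero]
    have := hr (f v)
    rwa [hf, hε.map_eq, one_smul] at this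

end RepGrading

/-- The grading of `End(V)` by the images of the components of `R`. -/
def repGrading {K : Type*} [AddCommGroup K] (α : G →+ K) (ℛ : G → Submodule F R) (V : Type*)
    [AddCommGroup V] [Module F V] [Module R V] [IsScalarTower F R V] (k : K) :
    Submodule F (Module.End F V) :=
  (induced α ℛ k).map (Algebra.lsmul F F V).toLinearMap

/-- The maps `R → End(V)` and `r ↦ r e` into `End(W)` have the same kernel. The latter respects
degrees modulo `Z`, so the images of the components stay independent. -/
theorem isGrading_repGrading (hℛ : IsGrading ℛ) (h : IsGradedModule ℛ 𝒲) {Z : AddSubgroup G}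
    {e : Centralizer R W} (he : e ∈ ⨆ k : Z, centGrading R 𝒲 k) {V : Type*} [AddCommGroup V]
    [Module F V] [Module R V] [IsScalarTower F R V]
    (hsurj : Function.Surjective (Algebra.lsmul F F V : R →ₐ[F] Module.End F V))
    (hann : ∀ r : R, (∀ v : V, r • v = 0) ↔ ∀ w, r • e.unop w = 0) :
    IsGrading (repGrading (QuotientAddGroup.mk' Z) ℛ V) := by
  let e' : Module.End F W := e.unop.restrictScalars F
  refine (hℛ.induced _).map (f := (Algebra.lsmul F F V).toLinearMap) hsurj
    (g := LinearMap.mulRight F e' ∘ₗ (Algebra.lsmul F F W).toLinearMap) (fun r => ?_)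
    (iSupIndep_endGrading (h.grading.induced (QuotientAddGroup.mk' Z))) fun k r hr j w hw => ?_
  · rw [LinearMap.ext_iff, LinearMap.ext_iff]
    exact hann r
  · exact (h.induced (QuotientAddGroup.mk' Z)).smul_mem hr (centralizer_mem_induced he hw)

theorem isRepGrading_repGrading (hℛ : IsGradedAlgebra ℛ) (h : IsGradedModule ℛ 𝒲)
    {Z : AddSubgroup G} {e : Centralizer R W} (he : e ∈ ⨆ k : Z, centGrading R 𝒲 k) {V : Type*}
    [AddCommGroup V] [Module F V] [Module R V] [IsScalarTower F R V]
    (hsurj : Function.Surjective (Algebra.lsmul F F V : R →ₐ[F] Module.End F V))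
    (hann : ∀ r : R, (∀ v : V, r • v = 0) ↔ ∀ w, r • e.unop w = 0) :
    IsRepGrading ℛ Z (repGrading (QuotientAddGroup.mk' Z) ℛ V) :=
  ⟨(hℛ.induced _).map (Algebra.lsmul F F V) (isGrading_repGrading hℛ.grading h he hsurj hann),
    fun _ r hr => ⟨r, hr, rfl⟩⟩

/-- The components of `ℰ` contain the images of those of `R`, which already span; an independent
family admits no spanning subfamily of smaller subspaces. -/
theorem IsRepGrading.eq_repGrading (hℛ : IsGrading ℛ) {Z : AddSubgroup G} {V : Type*}
    [AddCommGroup V] [Module F V] [Module R V] [IsScalarTower F R V]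
    (hsurj : Function.Surjective (Algebra.lsmul F F V : R →ₐ[F] Module.End F V))
    {ℰ : G ⧸ Z → Submodule F (Module.End F V)} (hℰ : IsRepGrading ℛ Z ℰ) :
    ℰ = repGrading (QuotientAddGroup.mk' Z) ℛ V := by
  refine ((hℰ.gradedAlgebra.grading.iSupIndep.le_iff_eq_of_iSup_eq_top ?_).mp ?_).symm
  · change ⨆ k, (induced (QuotientAddGroup.mk' Z) ℛ k).map (Algebra.lsmul F F V).toLinearMap = ⊤
    rw [← Submodule.map_iSup, (hℛ.induced _).iSup_eq_top, Submodule.map_top]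
    exact LinearMap.range_eq_top.mpr hsurj
  · rintro k _ ⟨r, hr, rfl⟩
    exact hℰ.map_mem k r hr

end GrMod

/-! ### Simple rings, graded isomorphisms and tensor products. -/

namespace GrMod

universe u

section SimpleRings

theorem isSimpleRing_of_surjective {A B : Type*} [Ring A] [Ring B] [IsSimpleRing A] [Nontrivial B]
    (f : A →+* B) (hf : Function.Surjective f) : IsSimpleRing B := by
  refine .of_eq_bot_or_eq_top fun I => or_iff_not_imp_left.mpr fun hI => ?_
  obtain ⟨x, hxI, hx : x ≠ 0⟩ := SetLike.exists_of_lt (bot_lt_iff_ne_bot.mpr hI : ⊥ < I)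
  obtain ⟨a, rfl⟩ := hf x
  have h1 : (1 : A) ∈ I.comap f := IsSimpleRing.one_mem_of_ne_zero_mem (I.comap f) (x := a)
    (by rintro rfl; exact hx (map_zero f)) ((TwoSidedIdeal.mem_comap f).mpr hxI)
  rw [← I.one_mem_iff]
  simpa using (TwoSidedIdeal.mem_comap f).mp h1

variable {F : Type*} [Field F]

theorem isSimpleRing_end (V : Type*) [AddCommGroup V] [Module F V] [FiniteDimensional F V]
    [Nontrivial V] : IsSimpleRing (Module.End F V) := by
  have : Nonempty (Fin (Module.finrank F V)) := Fin.pos_iff_nonempty.mp Module.finrank_pos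
  let e := algEquivMatrix (Module.finBasis F V)
  exact isSimpleRing_of_surjective e.symm.toRingHom e.symm.surjective

/-- A basis of `V` identifies this algebra with a matrix ring over `B`. -/
theorem isSimpleRing_end_tensor (V : Type*) [AddCommGroup V] [Module F V] [FiniteDimensional F V]
    [Nontrivial V] (B : Type*) [Ring B] [Algebra F B] [IsSimpleRing B] :
    IsSimpleRing (Module.End F V ⊗[F] B) := by
  have : Nonempty (Fin (Module.finrank F V)) := Fin.pos_iff_nonempty.mp Module.finrank_pos
  let e : Matrix (Fin (Module.finrank F V)) (Fin (Module.finrank F V)) B ≃ₐ[F]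
      Module.End F V ⊗[F] B :=
    (matrixEquivTensor (Fin (Module.finrank F V)) F B).trans
      ((Algebra.TensorProduct.comm F B _).trans
        (Algebra.TensorProduct.congr (algEquivMatrix (Module.finBasis F V)).symm .refl))
  have : Nontrivial (Module.End F V ⊗[F] B) := e.symm.surjective.nontrivial
  exact isSimpleRing_of_surjective e.toRingHom e.surjective

theorem isAzumaya_of_isSimpleRing [IsAlgClosed F] (A : Type*) [Ring A] [Algebra F A]
    [FiniteDimensional F A] [IsSimpleRing A] : IsAzumaya F A := by
  obtain ⟨n, hn, ⟨e⟩⟩ := IsSimpleRing.exists_algEquiv_matrix_of_isAlgClosed F A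
  have := IsAzumaya.matrix F (Fin n)
  exact IsAzumaya.of_AlgEquiv _ _ _ e.symm

end SimpleRings

theorem exists_algHom_of_ker_le {F A B C : Type*} [Field F] [Ring A] [Ring B] [Ring C]
    [Algebra F A] [Algebra F B] [Algebra F C] {φ : A →ₐ[F] B} (hφ : Function.Surjective φ)
    (ψ : A →ₐ[F] C) (h : ∀ a, φ a = 0 → ψ a = 0) : ∃ L : B →ₐ[F] C, ∀ a, L (φ a) = ψ a := by
  have h' : ∀ a b, φ a = φ b → ψ a = ψ b := fun a b hab => by
    rw [← sub_eq_zero, ← map_sub]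
    exact h _ (by rw [map_sub, hab, sub_self])
  choose s hs using hφ
  refine ⟨{ toFun := fun b => ψ (s b), map_one' := ?_, map_mul' := fun x y => ?_, map_zero' := ?_,
            map_add' := fun x y => ?_, commutes' := fun r => ?_ }, fun a => h' _ _ (hs _)⟩
  · rw [← map_one ψ]; exact h' _ _ (by rw [hs, map_one])
  · rw [← map_mul ψ]; exact h' _ _ (by rw [hs, map_mul, hs, hs])
  · rw [← map_zero ψ]; exact h' _ _ (by rw [hs, map_zero])
  · rw [← map_add ψ]; exact h' _ _ (by rw [hs, map_add, hs, hs])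
  · rw [← ψ.commutes]; exact h' _ _ (by rw [hs, φ.commutes])

variable {F : Type*} [Field F] {G : Type*}

/-- An isomorphism of graded algebras. -/
def IsGradedEquiv {A B : Type*} [Ring A] [Algebra F A] [Ring B] [Algebra F B] (e : A ≃ₐ[F] B)
    (𝒜 : G → Submodule F A) (ℬ : G → Submodule F B) : Prop :=
  ∀ k, (𝒜 k).map e.toLinearMap = ℬ k

namespace IsGradedEquiv

variable {A B C A' B' : Type*} [Ring A] [Algebra F A] [Ring B] [Algebra F B] [Ring C] [Algebra F C]
  [Ring A'] [Algebra F A'] [Ring B'] [Algebra F B'] {𝒜 : G → Submodule F A}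
  {ℬ : G → Submodule F B} {𝒞 : G → Submodule F C} {𝒜' : G → Submodule F A'}
  {ℬ' : G → Submodule F B'}

theorem of_le_of_symm_le {e : A ≃ₐ[F] B} (h : ∀ k, ∀ a ∈ 𝒜 k, e a ∈ ℬ k)
    (h' : ∀ k, ∀ b ∈ ℬ k, e.symm b ∈ 𝒜 k) : IsGradedEquiv e 𝒜 ℬ := fun k =>
  le_antisymm (Submodule.map_le_iff_le_comap.mpr fun a ha => h k a ha)
    fun b hb => ⟨e.symm b, h' k b hb, e.apply_symm_apply b⟩

/-- One inclusion suffices, since a spanning family below an independent one equals it. -/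
theorem of_le {e : A ≃ₐ[F] B} (h𝒜 : iSup 𝒜 = ⊤) (hℬ : iSupIndep ℬ)
    (h : ∀ k, ∀ a ∈ 𝒜 k, e a ∈ ℬ k) : IsGradedEquiv e 𝒜 ℬ := by
  have h1 : ⨆ k, (𝒜 k).map e.toLinearMap = ⊤ := by
    rw [← Submodule.map_iSup, h𝒜, Submodule.map_top]
    exact LinearMap.range_eq_top.mpr e.surjective
  exact congrFun ((hℬ.le_iff_eq_of_iSup_eq_top h1).mp fun k =>
    Submodule.map_le_iff_le_comap.mpr fun a ha => h k a ha)

theorem apply_mem {e : A ≃ₐ[F] B} (h : IsGradedEquiv e 𝒜 ℬ) {k : G} {a : A} (ha : a ∈ 𝒜 k) :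
    e a ∈ ℬ k := h k ▸ ⟨a, ha, rfl⟩

theorem symm_apply_mem {e : A ≃ₐ[F] B} (h : IsGradedEquiv e 𝒜 ℬ) {k : G} {b : B} (hb : b ∈ ℬ k) :
    e.symm b ∈ 𝒜 k := by
  rw [← h k] at hb
  obtain ⟨a, ha, rfl⟩ := hb
  have : e.symm (e.toLinearMap a) = a := e.symm_apply_apply a
  rwa [this]

theorem refl : IsGradedEquiv .refl 𝒜 𝒜 := of_le_of_symm_le (fun _ _ h => h) fun _ _ h => h

theorem symm {e : A ≃ₐ[F] B} (h : IsGradedEquiv e 𝒜 ℬ) : IsGradedEquiv e.symm ℬ 𝒜 :=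
  of_le_of_symm_le (fun _ _ hb => h.symm_apply_mem hb) fun _ _ ha => h.apply_mem ha

theorem trans {e : A ≃ₐ[F] B} {e' : B ≃ₐ[F] C} (h : IsGradedEquiv e 𝒜 ℬ)
    (h' : IsGradedEquiv e' ℬ 𝒞) : IsGradedEquiv (e.trans e') 𝒜 𝒞 :=
  of_le_of_symm_le (fun _ _ ha => h'.apply_mem (h.apply_mem ha))
    fun _ _ hc => h.symm_apply_mem (h'.symm_apply_mem hc)

end IsGradedEquiv

section Tensor

variable [AddCommGroup G] {A B C A' B' : Type*} [Ring A] [Algebra F A] [Ring B] [Algebra F B]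
  [Ring C] [Algebra F C] [Ring A'] [Algebra F A'] [Ring B'] [Algebra F B']
  {𝒜 : G → Submodule F A} {ℬ : G → Submodule F B} {𝒞 : G → Submodule F C}
  {𝒜' : G → Submodule F A'} {ℬ' : G → Submodule F B'}

theorem tmul_mem_tensorGrading {i j : G} {a : A} {b : B} (ha : a ∈ 𝒜 i) (hb : b ∈ ℬ j) :
    a ⊗ₜ[F] b ∈ tensorGrading 𝒜 ℬ (i + j) := by
  refine Submodule.mem_iSup_of_mem i (Submodule.mem_iSup_of_mem j (Submodule.mem_iSup_of_mem rfl ?_))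
  exact Submodule.apply_mem_map₂ _ ha hb

theorem tensorGrading_map_mem {X : Type*} [AddCommGroup X] [Module F X] {f : A ⊗[F] B →ₗ[F] X}
    {k : G} {N : Submodule F X}
    (h : ∀ i j, i + j = k → ∀ a ∈ 𝒜 i, ∀ b ∈ ℬ j, f (a ⊗ₜ b) ∈ N) {x : A ⊗[F] B}
    (hx : x ∈ tensorGrading 𝒜 ℬ k) : f x ∈ N := by
  suffices tensorGrading 𝒜 ℬ k ≤ N.comap f from this hx
  exact iSup_le fun i => iSup_le fun j => iSup_le fun hij => Submodule.map₂_le.mpr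
    fun a ha b hb => h i j hij a ha b hb

theorem iSup_tensorGrading (h𝒜 : iSup 𝒜 = ⊤) (hℬ : iSup ℬ = ⊤) :
    iSup (tensorGrading 𝒜 ℬ) = ⊤ := by
  refine (Submodule.eq_top_iff').mpr fun x => ?_
  induction x with
  | zero => exact zero_mem _
  | add x y hx hy => exact add_mem hx hy
  | tmul a b =>
    have ha : a ∈ iSup 𝒜 := h𝒜 ▸ Submodule.mem_top
    have hb : b ∈ iSup ℬ := hℬ ▸ Submodule.mem_top
    induction ha using Submodule.iSup_induction' with
    | zero => rw [TensorProduct.zero_tmul]; exact zero_mem _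
    | add a a' _ _ ha ha' => rw [TensorProduct.add_tmul]; exact add_mem ha ha'
    | mem i a ha =>
      induction hb using Submodule.iSup_induction' with
      | zero => rw [TensorProduct.tmul_zero]; exact zero_mem _
      | add b b' _ _ hb hb' => rw [TensorProduct.tmul_add]; exact add_mem hb hb'
      | mem j b hb => exact Submodule.mem_iSup_of_mem (i + j) (tmul_mem_tensorGrading ha hb)

theorem IsGradedEquiv.congr {e : A ≃ₐ[F] A'} {e' : B ≃ₐ[F] B'} (h : IsGradedEquiv e 𝒜 𝒜')
    (h' : IsGradedEquiv e' ℬ ℬ') :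
    IsGradedEquiv (Algebra.TensorProduct.congr e e') (tensorGrading 𝒜 ℬ)
      (tensorGrading 𝒜' ℬ') := by
  refine of_le_of_symm_le (fun k x hx => ?_) fun k x hx => ?_
  · refine tensorGrading_map_mem (f := (Algebra.TensorProduct.congr e e').toLinearMap) ?_ hx
    rintro i j rfl a ha b hb
    exact tmul_mem_tensorGrading (h.apply_mem ha) (h'.apply_mem hb)
  · refine tensorGrading_map_mem (f := (Algebra.TensorProduct.congr e e').symm.toLinearMap) ?_ hx
    rintro i j rfl a ha b hb
    exact tmul_mem_tensorGrading (h.symm_apply_mem ha) (h'.symm_apply_mem hb)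

theorem tensorGrading_leftComm_mem {k : G} {x : A ⊗[F] (B ⊗[F] C)}
    (hx : x ∈ tensorGrading 𝒜 (tensorGrading ℬ 𝒞) k) :
    Algebra.TensorProduct.leftComm F A B C x ∈ tensorGrading ℬ (tensorGrading 𝒜 𝒞) k := by
  refine tensorGrading_map_mem (f := (Algebra.TensorProduct.leftComm F A B C).toLinearMap) ?_ hx
  rintro i j rfl a ha y hy
  refine tensorGrading_map_mem (f := (Algebra.TensorProduct.leftComm F A B C).toLinearMap ∘ₗ
    TensorProduct.mk F A (B ⊗[F] C) a) ?_ hy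
  rintro j l rfl b hb c hc
  rw [add_left_comm]
  exact tmul_mem_tensorGrading hb (tmul_mem_tensorGrading ha hc)

theorem isGradedEquiv_leftComm :
    IsGradedEquiv (Algebra.TensorProduct.leftComm F A B C) (tensorGrading 𝒜 (tensorGrading ℬ 𝒞))
      (tensorGrading ℬ (tensorGrading 𝒜 𝒞)) :=
  .of_le_of_symm_le (fun _ _ hx => tensorGrading_leftComm_mem hx) fun _ _ hx =>
    tensorGrading_leftComm_mem hx

/-- The grading of the opposite algebra. -/
def opGrading (𝒜 : G → Submodule F A) (k : G) : Submodule F Aᵐᵒᵖ :=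
  (𝒜 k).map (MulOpposite.opLinearEquiv F).toLinearMap

omit [AddCommGroup G] in
theorem isGrading_opGrading (h : IsGrading 𝒜) : IsGrading (opGrading 𝒜) :=
  h.map_equiv (MulOpposite.opLinearEquiv F)

/-- `A ⊗ Aᵒᵖ ≃ End(A)` as graded algebras. -/
theorem exists_mulLeftRight_equiv [IsAlgClosed F] [FiniteDimensional F A] [IsSimpleRing A]
    (h : IsGradedAlgebra 𝒜) : ∃ b : (A ⊗[F] Aᵐᵒᵖ) ≃ₐ[F] Module.End F A,
      IsGradedEquiv b (tensorGrading 𝒜 (opGrading 𝒜)) (endGrading 𝒜) := by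
  have := isAzumaya_of_isSimpleRing (F := F) A
  refine ⟨AlgEquiv.ofBijective (AlgHom.mulLeftRight F A) IsAzumaya.bij, .of_le
    (iSup_tensorGrading h.grading.iSup_eq_top (isGrading_opGrading h.grading).iSup_eq_top)
    (iSupIndep_endGrading h.grading) fun k x hx => ?_⟩
  refine tensorGrading_map_mem (f := (AlgHom.mulLeftRight F A).toLinearMap) ?_ hx
  rintro i j rfl a ha _ ⟨b, hb, rfl⟩ l c hc
  change AlgHom.mulLeftRight F A (a ⊗ₜ MulOpposite.op b) c ∈ _
  rw [AlgHom.mulLeftRight_apply, MulOpposite.unop_op, add_right_comm]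
  exact h.mul_mem (h.mul_mem ha hc) hb

theorem isGradedEquiv_conj {V V' : Type*} [AddCommGroup V] [Module F V] [AddCommGroup V']
    [Module F V'] {𝒱 : G → Submodule F V} (e : V ≃ₗ[F] V') :
    IsGradedEquiv (e.conjAlgEquiv F) (endGrading 𝒱)
      (endGrading fun k => (𝒱 k).map e.toLinearMap) := by
  refine .of_le_of_symm_le (fun k f hf => ?_) fun k f hf j v hv => ?_
  · rintro j _ ⟨v, hv, rfl⟩
    exact ⟨f v, hf j v hv, by simp [LinearEquiv.conjAlgEquiv_apply]⟩
  · obtain ⟨w, hw, hwe⟩ := hf j (e v) ⟨v, hv, rfl⟩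
    have : (e.conjAlgEquiv F).symm f v = w := by
      change e.symm (f (e v)) = w
      rw [← hwe]
      exact e.symm_apply_apply w
    rwa [this]

end Tensor

/-- `BrauerEq` asks for spaces in the universe of `F`; coordinates in a basis transport `V` and `V'`
there. -/
theorem BrauerEq.of_equiv {F : Type u} [Field F] [AddCommGroup G] {A B V V' : Type*} [Ring A]
    [Algebra F A] [Ring B] [Algebra F B] {𝒜 : G → Submodule F A} {ℬ : G → Submodule F B}
    (h𝒜 : IsGradedCSA 𝒜) (hℬ : IsGradedCSA ℬ) [AddCommGroup V] [Module F V] [AddCommGroup V']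
    [Module F V'] [Nontrivial V] [Nontrivial V'] [FiniteDimensional F V] [FiniteDimensional F V']
    {𝒱 : G → Submodule F V} {𝒱' : G → Submodule F V'} (h𝒱 : IsGrading 𝒱) (h𝒱' : IsGrading 𝒱')
    {e : (A ⊗[F] Module.End F V) ≃ₐ[F] (B ⊗[F] Module.End F V')}
    (he : IsGradedEquiv e (tensorGrading 𝒜 (endGrading 𝒱)) (tensorGrading ℬ (endGrading 𝒱'))) :
    BrauerEq 𝒜 ℬ := by
  let v := (Module.finBasis F V).equivFun
  let v' := (Module.finBasis F V').equivFun
  refine ⟨h𝒜, hℬ, Fin (Module.finrank F V) → F, Fin (Module.finrank F V') → F, inferInstance,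
    inferInstance, inferInstance, inferInstance, _, _, v.symm.toEquiv.nontrivial,
    v'.symm.toEquiv.nontrivial, inferInstance, inferInstance, h𝒱.map_equiv v, h𝒱'.map_equiv v',
    _, ((IsGradedEquiv.congr .refl (isGradedEquiv_conj v).symm).trans he).trans
      (.congr .refl (isGradedEquiv_conj v'))⟩

theorem BrauerEq.congr_left {F : Type u} [Field F] [AddCommGroup G] {A A' B : Type*} [Ring A]
    [Algebra F A] [Ring A'] [Algebra F A'] [Ring B] [Algebra F B] {𝒜 : G → Submodule F A}
    {𝒜' : G → Submodule F A'} {ℬ : G → Submodule F B} (h : BrauerEq 𝒜 ℬ) (h𝒜' : IsGradedCSA 𝒜')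
    {e : A' ≃ₐ[F] A} (he : IsGradedEquiv e 𝒜' 𝒜) : BrauerEq 𝒜' ℬ := by
  obtain ⟨-, hℬ, V, V', _, _, _, _, 𝒱, 𝒱', hV, hV', hVf, hVf', h𝒱, h𝒱', f, hf⟩ := h
  exact ⟨h𝒜', hℬ, V, V', _, _, _, _, 𝒱, 𝒱', hV, hV', hVf, hVf', h𝒱, h𝒱', _,
    (IsGradedEquiv.congr he .refl).trans hf⟩

end GrMod

/-! ### Corners of central idempotents and the Brauer invariant. -/

namespace GrMod

universe u

section Corner

variable {F : Type*} [Field F] {D : Type*} [Ring D] [Algebra F D] {e : D}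

theorem corner_mul_self (he : IsIdempotentElem e) (x : he.Corner) : x.1 * e = x.1 :=
  ((Subsemigroup.mem_corner_iff he).mp x.2).2

/-- The homomorphism `d ↦ d e` onto the corner of a central idempotent `e`. -/
def cornerProj (he : IsIdempotentElem e) (hc : ∀ x, x * e = e * x) : D →ₐ[F] he.Corner :=
  AlgHom.ofLinearMap
    { toFun := fun d => ⟨d * e, ⟨d, by
        change e * d * e = d * e
        rw [← hc, mul_assoc, he]⟩⟩
      map_add' := fun a b => Subtype.ext (add_mul a b e)
      map_smul' := fun r a => Subtype.ext (smul_mul_assoc r a e) }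
    (Subtype.ext (one_mul e))
    (fun a b => Subtype.ext (by
      change a * b * e = a * e * (b * e)
      rw [mul_assoc a e, ← mul_assoc e b e, ← hc b, mul_assoc b, he, mul_assoc]))

theorem cornerProj_coe (he : IsIdempotentElem e) (hc : ∀ x, x * e = e * x) (x : he.Corner) :
    cornerProj (F := F) he hc x.1 = x := Subtype.ext (corner_mul_self he x)

theorem cornerGrading_eq_map {K : Type*} (𝒜 : K → Submodule F D) (he : IsIdempotentElem e)
    (hc : ∀ x, x * e = e * x) :
    cornerGrading 𝒜 he = fun k => (𝒜 k).map (cornerProj he hc).toLinearMap := by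
  ext k x
  constructor
  · rintro ⟨a, ha, hx⟩
    exact ⟨a, ha, Subtype.ext hx.symm⟩
  · rintro ⟨a, ha, rfl⟩
    exact ⟨a, ha, rfl⟩

end Corner

namespace IsGradedDivision

variable {F : Type*} [Field F] {G D : Type*} [AddCommGroup G] [Ring D] [Algebra F D]
  {𝒟 : G → Submodule F D} [FiniteDimensional F D]
  {ρ : Subalgebra.center F D →ₐ[F] F} {ε : Subalgebra.center F D}

omit [FiniteDimensional F D] in
theorem isGradedAlgebra_corner (h : IsGradedDivision 𝒟) (ε : Subalgebra.center F D)
    (he : IsIdempotentElem (ε : D)) :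
    IsGradedAlgebra (cornerGrading (induced (QuotientAddGroup.mk' h.centerSupp) 𝒟) he) := by
  have hc : ∀ x, x * (ε : D) = ε * x := Subalgebra.mem_center_iff (R := F).mp ε.2
  have hA := h.gradedAlgebra.induced (QuotientAddGroup.mk' h.centerSupp)
  have hε0 : (ε : D) ∈ induced (QuotientAddGroup.mk' h.centerSupp) 𝒟 0 := by
    have : (ε : D) ∈ ⨆ z : h.centerSupp, 𝒟 z := h.toSubmodule_center ▸ ε.2
    refine (iSup_le fun z => ?_ : ⨆ z : h.centerSupp, 𝒟 z ≤ _) this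
    rw [← show (QuotientAddGroup.mk' h.centerSupp) (z : G) = 0 from
      (QuotientAddGroup.eq_zero_iff _).mpr z.2]
    exact le_induced _ _
  rw [cornerGrading_eq_map _ he hc]
  refine hA.map (cornerProj he hc) (hA.grading.map (f := (cornerProj he hc).toLinearMap)
    (fun x => ⟨x.1, cornerProj_coe (F := F) he hc x⟩)
    (g := LinearMap.mulRight F (ε : D)) (fun d => ?_) hA.grading.iSupIndep fun k d hd => ?_)
  · exact Subtype.ext_iff
  · have := hA.mul_mem hd hε0
    rwa [add_zero] at this

/-- Central elements of the corner are central in `D`, hence multiples of `ε` through `ρ`. For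
simplicity, the preimage in `D` of a nonzero ideal is a two-sided ideal meeting `D ε`. -/
theorem isGradedCSA_corner (h : IsGradedDivision 𝒟) (hchar : ¬ ringChar F ∣ Module.finrank F D)
    (hε : IsCharIdempotent ρ ε) (he : IsIdempotentElem (ε : D)) :
    IsGradedCSA (cornerGrading (induced (QuotientAddGroup.mk' h.centerSupp) 𝒟) he) := by
  have hc : ∀ x, x * (ε : D) = ε * x := Subalgebra.mem_center_iff (R := F).mp ε.2
  have hε0 : (ε : D) ≠ 0 := fun e => hε.ne_zero (Subtype.ext e)
  let π := cornerProj (F := F) he hc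
  have hπ : ∀ x : he.Corner, π x.1 = x := cornerProj_coe he hc
  refine ⟨h.isGradedAlgebra_corner ε he, ?_, ⟨fun x hx => ?_⟩, ?_⟩
  · exact Module.Finite.of_surjective π.toLinearMap fun x => ⟨x.1, hπ x⟩
  · rw [Subalgebra.mem_center_iff] at hx
    have hxc : x.1 ∈ Subalgebra.center F D := by
      rw [Subalgebra.mem_center_iff]
      intro d
      have h1 : d * ε * x.1 = x.1 * (d * ε) := congrArg Subtype.val (hx (π d))
      rwa [mul_assoc, ← hc, corner_mul_self, ← mul_assoc, mul_assoc, hc, ← mul_assoc,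
        corner_mul_self] at h1
    refine Algebra.mem_bot.mpr ⟨ρ ⟨x.1, hxc⟩, ?_⟩
    rw [Algebra.algebraMap_eq_smul_one]
    have h1 := congrArg Subtype.val (hε.mul_eq ⟨x.1, hxc⟩)
    exact Subtype.ext (h1.symm.trans (corner_mul_self he x))
  · have : Nontrivial he.Corner := ⟨⟨1, 0, fun e => hε0 (congrArg Subtype.val e)⟩⟩
    refine .of_eq_bot_or_eq_top fun I => or_iff_not_imp_left.mpr fun hI => ?_
    obtain ⟨x, hxI, hx : x ≠ 0⟩ := SetLike.exists_of_lt (bot_lt_iff_ne_bot.mpr hI : ⊥ < I)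
    let J : Submodule F D :=
      { carrier := {d | π d ∈ I}
        add_mem' := fun {a b} ha hb => by
          change π (a + b) ∈ I
          rw [map_add]
          exact I.add_mem ha hb
        zero_mem' := by
          change π 0 ∈ I
          rw [map_zero]
          exact I.zero_mem
        smul_mem' := fun r d hd => by
          change π (r • d) ∈ I
          rw [Algebra.smul_def, map_mul]
          exact I.mul_mem_left _ _ hd }
    have hεJ : (ε : D) ∈ J := h.mem_of_mem_twoSided hchar hε J
      (fun a d hd => by
        change π (a * d) ∈ I
        rw [map_mul]
        exact I.mul_mem_left _ _ hd)
      (fun a d hd => by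
        change π (d * a) ∈ I
        rw [map_mul]
        exact I.mul_mem_right _ _ hd)
      (d := x.1) (by
        change π x.1 ∈ I
        rwa [hπ]) (fun e => hx (Subtype.ext e)) (corner_mul_self he x)
    rw [← I.one_mem_iff]
    have h1 : π (ε : D) = 1 := Subtype.ext he
    rw [← h1]
    exact hεJ

theorem exists_corner_equiv [IsAlgClosed F] (h : IsGradedDivision 𝒟)
    (hchar : ¬ ringChar F ∣ Module.finrank F D)
    {ρ' : Subalgebra.center F D →ₐ[F] F} {ε' : Subalgebra.center F D}
    (hε : IsCharIdempotent ρ ε) (hε' : IsCharIdempotent ρ' ε') (he : IsIdempotentElem (ε : D))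
    (he' : IsIdempotentElem (ε' : D)) : ∃ θ : he.Corner ≃ₐ[F] he'.Corner,
      IsGradedEquiv θ (cornerGrading (induced (QuotientAddGroup.mk' h.centerSupp) 𝒟) he)
        (cornerGrading (induced (QuotientAddGroup.mk' h.centerSupp) 𝒟) he') := by
  obtain ⟨θ, hθ, hθε⟩ := h.exists_automorphism hchar hε hε'
  have hθε' : θ.symm ε' = ε := by rw [← hθε, AlgEquiv.symm_apply_apply]
  let θ' : he.Corner ≃ₐ[F] he'.Corner :=
    { toFun := fun x => ⟨θ x.1, by
        obtain ⟨d, hd⟩ := x.2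
        refine ⟨θ d, ?_⟩
        change (ε' : D) * θ d * ε' = θ x.1
        rw [← hθε, ← map_mul, ← map_mul]
        exact congrArg θ hd⟩
      invFun := fun x => ⟨θ.symm x.1, by
        obtain ⟨d, hd⟩ := x.2
        refine ⟨θ.symm d, ?_⟩
        change (ε : D) * θ.symm d * ε = θ.symm x.1
        rw [← hθε', ← map_mul, ← map_mul]
        exact congrArg θ.symm hd⟩
      left_inv := fun x => Subtype.ext (θ.symm_apply_apply x.1)
      right_inv := fun x => Subtype.ext (θ.apply_symm_apply x.1)
      map_mul' := fun x y => Subtype.ext (map_mul θ x.1 y.1)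
      map_add' := fun x y => Subtype.ext (map_add θ x.1 y.1)
      commutes' := fun r => Subtype.ext (by
        change θ (r • (ε : D)) = r • (ε' : D)
        rw [map_smul, hθε]) }
  refine ⟨θ', .of_le (h.isGradedAlgebra_corner ε he).grading.iSup_eq_top
    (h.isGradedAlgebra_corner ε' he').grading.iSupIndep ?_⟩
  rintro k x ⟨a, ha, hx⟩
  refine ⟨θ a, ?_, ?_⟩
  · refine map_iSup_induced _ (f := θ.toLinearMap) (fun g hg d hd => ?_) ha
    rw [← hg]
    exact mem_induced _ (hθ g d hd)
  · change θ x.1 = θ a * ε'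
    rw [hx, map_mul, hθε]

end IsGradedDivision

section BrauerInvariant

variable {F : Type u} [Field F] {G : Type*} [AddCommGroup G] {R : Type*} [Ring R]
  [Algebra F R] {ℛ : G → Submodule F R} {W : Type*} [AddCommGroup W] [Module F W] [Module R W]
  [IsScalarTower F R W] {𝒲 : G → Submodule F W}

/-- The action of the opposite of the corner `C(W) e` on `W e`. -/
def cornerAction {e : Centralizer R W} (he : IsIdempotentElem e) :
    he.Cornerᵐᵒᵖ →ₐ[F] Module.End F (LinearMap.range e.unop) :=
  AlgHom.ofLinearMap
    { toFun := fun x =>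
        { toFun := fun m => ⟨x.unop.1.unop m.1, ⟨x.unop.1.unop m.1,
            congrArg (fun c : Centralizer R W => c.unop m.1) (corner_mul_self he x.unop)⟩⟩
          map_add' := fun m m' => Subtype.ext (map_add x.unop.1.unop m.1 m'.1)
          map_smul' := fun r m => Subtype.ext (LinearMap.map_smul_of_tower x.unop.1.unop r m.1) }
      map_add' := fun _ _ => rfl
      map_smul' := fun _ _ => rfl }
    (LinearMap.ext fun m => Subtype.ext (apply_eq_self_of_mem_range he m.2))
    (fun _ _ => rfl)

theorem coe_cornerAction {e : Centralizer R W} (he : IsIdempotentElem e) (x : he.Cornerᵐᵒᵖ)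
    (m : LinearMap.range e.unop) :
    (cornerAction (F := F) he x m : W) = x.unop.1.unop m.1 := rfl

/-- The grading of the submodule `W e`. -/
def rangeGrading {K : Type*} (𝒲 : K → Submodule F W) (e : Centralizer R W) (k : K) :
    Submodule F (LinearMap.range e.unop) :=
  (𝒲 k).map (e.unop.rangeRestrict.restrictScalars F)

theorem isGrading_rangeGrading (h : IsGradedModule ℛ 𝒲) {Z : AddSubgroup G} {e : Centralizer R W}
    (he : e ∈ ⨆ k : Z, centGrading R 𝒲 k) :
    IsGrading (rangeGrading (induced (QuotientAddGroup.mk' Z) 𝒲) e) := by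
  have hW := h.grading.induced (QuotientAddGroup.mk' Z)
  refine hW.map (f := e.unop.rangeRestrict.restrictScalars F) e.unop.surjective_rangeRestrict
    (g := e.unop.restrictScalars F) (fun w => ?_) hW.iSupIndep fun k w hw =>
      centralizer_mem_induced he hw
  exact Subtype.ext_iff

theorem mem_rangeGrading_iff {Z : AddSubgroup G} {e : Centralizer R W} (hi : IsIdempotentElem e)
    (he : e ∈ ⨆ k : Z, centGrading R 𝒲 k) {k : G ⧸ Z} {m : LinearMap.range e.unop} :
    m ∈ rangeGrading (induced (QuotientAddGroup.mk' Z) 𝒲) e k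
      ↔ m.1 ∈ induced (QuotientAddGroup.mk' Z) 𝒲 k := by
  constructor
  · rintro ⟨w, hw, rfl⟩
    exact centralizer_mem_induced he hw
  · exact fun hm => ⟨m.1, hm, Subtype.ext (apply_eq_self_of_mem_range hi m.2)⟩

variable [IsAlgClosed F] [FiniteDimensional F W] {ε : Subalgebra.center F (Centralizer R W)}

/-- `End(V) ⊗ (C(W) ε)ᵒᵖ ≃ End(W ε)` as graded algebras. -/
theorem exists_doubleCentralizer_equiv (hℛ : IsGradedAlgebra ℛ) (h : IsGradedModule ℛ 𝒲)
    (hs : IsGradedSimple R 𝒲) (hchar : ¬ ringChar F ∣ Module.finrank F (Centralizer R W))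
    {Z : AddSubgroup G} (hZ : Z = (isGradedDivision_centGrading hℛ.grading h hs).centerSupp)
    {ρ : Subalgebra.center F (Centralizer R W) →ₐ[F] F} (hε : IsCharIdempotent ρ ε)
    (he : IsIdempotentElem (ε : Centralizer R W)) (V : Submodule R W) [IsSimpleModule R V]
    (hann : ∀ r : R, (∀ v : V, r • v = 0) ↔ ∀ w, r • (ε : Centralizer R W).unop w = 0) :
    ∃ a : (Module.End F V ⊗[F] he.Cornerᵐᵒᵖ) ≃ₐ[F]
        Module.End F (LinearMap.range (ε : Centralizer R W).unop),
      IsGradedEquiv a (tensorGrading (repGrading (QuotientAddGroup.mk' Z) ℛ V)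
        (opGrading (cornerGrading (induced (QuotientAddGroup.mk' Z) (centGrading R 𝒲)) he)))
        (endGrading (rangeGrading (induced (QuotientAddGroup.mk' Z) 𝒲)
          (ε : Centralizer R W))) := by
  subst hZ
  have hDf : FiniteDimensional F (Centralizer R W) := finiteDimensional_centralizer
  have hD := isGradedDivision_centGrading hℛ.grading h hs
  have hVn : Nontrivial V := IsSimpleModule.nontrivial R V
  have hVf : FiniteDimensional F V :=
    FiniteDimensional.of_injective (V.subtype.restrictScalars F) Subtype.val_injective
  have hc : ∀ x, x * (ε : Centralizer R W) = ε * x := Subalgebra.mem_center_iff.mp ε.2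
  have hmem : (ε : Centralizer R W) ∈ ⨆ k : hD.centerSupp, centGrading R 𝒲 k :=
    hD.toSubmodule_center ▸ ε.2
  let M := LinearMap.range (ε : Centralizer R W).unop
  have hMf : FiniteDimensional F M :=
    FiniteDimensional.of_injective (M.subtype.restrictScalars F) Subtype.val_injective
  have hMn : Nontrivial M := by
    rw [Submodule.nontrivial_iff_ne_bot, Ne, LinearMap.range_eq_bot]
    exact fun e => hε.ne_zero (Subtype.ext (MulOpposite.unop_injective e))
  -- Equality of annihilators lets the action of `R` on `W ε` factor through `End(V)`.
  obtain ⟨L, hL⟩ := exists_algHom_of_ker_le (F := F)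
    (lsmul_surjective (F := F) (A := R) (M := V)) (Algebra.lsmul F F M) fun r hr => by
      refine LinearMap.ext fun ⟨_, w, rfl⟩ => Subtype.ext ?_
      exact (hann r).mp (LinearMap.congr_fun hr) w
  have hcommute : ∀ x y, Commute (L x) (cornerAction he y) := by
    intro x y
    obtain ⟨r, rfl⟩ := lsmul_surjective (F := F) (A := R) (M := V) x
    rw [hL]
    exact LinearMap.ext fun m => Subtype.ext (y.unop.1.unop.map_smul r m.1).symm
  let a := Algebra.TensorProduct.lift L (cornerAction he) hcommute
  have ha : ∀ x y, a (x ⊗ₜ y) = L x * cornerAction he y := fun x y =>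
    Algebra.TensorProduct.lift_tmul L (cornerAction he) hcommute x y
  -- A subspace stable under the image of `a` is stable under both `R` and `C(W)`, so
  -- `range_le_of_bimodule` applies.
  have hsimple : IsSimpleOrder (Submodule a.range M) := by
    refine ⟨fun N => ?_⟩
    have hNR : ∀ (r : R), ∀ m ∈ N, r • m ∈ N := fun r m hm => by
      have h1 : a (Algebra.lsmul F F V r ⊗ₜ 1) m ∈ N := N.smul_mem (⟨_, ⟨_, rfl⟩⟩ : a.range) hm
      rwa [ha, hL, map_one, mul_one] at h1
    have hND : ∀ (c : he.Corner), ∀ m ∈ N, cornerAction he (.op c) m ∈ N := fun c m hm => by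
      have h1 : a (1 ⊗ₜ .op c) m ∈ N := N.smul_mem (⟨_, ⟨_, rfl⟩⟩ : a.range) hm
      rwa [ha, map_one, one_mul] at h1
    let N' : Submodule R M := { N.toAddSubmonoid with smul_mem' := hNR }
    refine or_iff_not_imp_left.mpr fun hN => ?_
    have hle := range_le_of_bimodule hℛ.grading h hs hchar hε (N := N'.map M.subtype)
      (fun e => hN ?_) ?_ ?_
    · refine (Submodule.eq_top_iff').mpr fun m => ?_
      obtain ⟨m', hm', hmm'⟩ := hle m.2
      rwa [← show m' = m from Subtype.ext hmm']
    · refine (Submodule.eq_bot_iff _).mpr fun m hm => ?_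
      have h1 : M.subtype m ∈ N'.map M.subtype := ⟨m, hm, rfl⟩
      rw [e] at h1
      exact Subtype.ext h1
    · exact Submodule.map_subtype_le M N'
    · rintro c _ ⟨m, hm, rfl⟩
      refine ⟨_, hND (cornerProj (F := F) he hc c) m hm, ?_⟩
      change (ε : Centralizer R W).unop (c.unop m.1) = c.unop m.1
      obtain ⟨w, hw⟩ := m.2
      rw [← hw]
      have h1 : (ε : Centralizer R W) * c * ε = ε * c := by rw [← hc c, mul_assoc, he]
      exact congrArg (fun c : Centralizer R W => c.unop w) h1
  have hsurj : Function.Surjective a := by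
    intro f
    have : IsSimpleModule a.range M := ⟨⟩
    obtain ⟨⟨_, ⟨x, rfl⟩⟩, hx⟩ := lsmul_surjective (F := F) (A := a.range) (M := M) f
    exact ⟨x, hx⟩
  have hCSA := hD.isGradedCSA_corner hchar hε he
  -- The source is a simple ring, being a matrix algebra over the opposite of a simple corner.
  have hinj : Function.Injective a := by
    have := hCSA.simple
    have := isSimpleRing_end_tensor V (he.Cornerᵐᵒᵖ) (F := F)
    exact a.toRingHom.injective
  refine ⟨AlgEquiv.ofBijective a ⟨hinj, hsurj⟩, .of_le (iSup_tensorGrading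
    (isGrading_repGrading hℛ.grading h hmem lsmul_surjective hann).iSup_eq_top
    (isGrading_opGrading hCSA.gradedAlgebra.grading).iSup_eq_top)
    (iSupIndep_endGrading (isGrading_rangeGrading h hmem)) fun k x hx => ?_⟩
  refine tensorGrading_map_mem (f := a.toLinearMap) ?_ hx
  rintro i j rfl _ ⟨r, hr, rfl⟩ _ ⟨y, ⟨c, hcj, hy⟩, rfl⟩ k m hm
  change a (Algebra.lsmul F F V r ⊗ₜ .op y) m ∈ _
  rw [mem_rangeGrading_iff he hmem] at hm ⊢
  rw [ha, hL, add_assoc]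
  refine (h.induced (QuotientAddGroup.mk' hD.centerSupp)).smul_mem hr ?_
  rw [coe_cornerAction]
  change y.1.unop m.1 ∈ _
  rw [hy]
  exact centralizer_mem_induced hmem
    (induced_centGrading_apply_mem hcj hm)

/-- With `C = C(W) ε`, the graded isomorphisms are `C ⊗ End(W ε) ≃ C ⊗ (End(V) ⊗ Cᵒᵖ) ≃ End(V) ⊗ (C
⊗ Cᵒᵖ) ≃ End(V) ⊗ End(C)`. -/
theorem brauerEq_corner (hℛ : IsGradedAlgebra ℛ) (h : IsGradedModule ℛ 𝒲)
    (hs : IsGradedSimple R 𝒲) (hchar : ¬ ringChar F ∣ Module.finrank F (Centralizer R W))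
    {Z : AddSubgroup G} (hZ : Z = (isGradedDivision_centGrading hℛ.grading h hs).centerSupp)
    {ρ : Subalgebra.center F (Centralizer R W) →ₐ[F] F} (hε : IsCharIdempotent ρ ε)
    (he : IsIdempotentElem (ε : Centralizer R W)) (V : Submodule R W) [IsSimpleModule R V]
    (hann : ∀ r : R, (∀ v : V, r • v = 0) ↔ ∀ w, r • (ε : Centralizer R W).unop w = 0) :
    BrauerEq (cornerGrading (induced (QuotientAddGroup.mk' Z) (centGrading R 𝒲)) he)
      (repGrading (QuotientAddGroup.mk' Z) ℛ V) := by
  obtain ⟨a, ha⟩ := exists_doubleCentralizer_equiv hℛ h hs hchar hZ hε he V hann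
  have hDf : FiniteDimensional F (Centralizer R W) := finiteDimensional_centralizer
  have hD := isGradedDivision_centGrading hℛ.grading h hs
  have hmem : (ε : Centralizer R W) ∈ ⨆ k : Z, centGrading R 𝒲 k := by
    rw [hZ, ← hD.toSubmodule_center]
    exact ε.2
  have hVn : Nontrivial V := IsSimpleModule.nontrivial R V
  have hVf : FiniteDimensional F V :=
    FiniteDimensional.of_injective (V.subtype.restrictScalars F) Subtype.val_injective
  have hCSA : IsGradedCSA (cornerGrading
      (induced (QuotientAddGroup.mk' Z) (centGrading R 𝒲)) he) := by
    rw [hZ]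
    exact hD.isGradedCSA_corner hchar hε he
  have hsimple := hCSA.simple
  have hfin := hCSA.finiteDimensional
  obtain ⟨b, hb⟩ := exists_mulLeftRight_equiv hCSA.gradedAlgebra
  have hMf : FiniteDimensional F (LinearMap.range (ε : Centralizer R W).unop) :=
    FiniteDimensional.of_injective ((LinearMap.range _).subtype.restrictScalars F)
      Subtype.val_injective
  have hMn : Nontrivial (LinearMap.range (ε : Centralizer R W).unop) := by
    rw [Submodule.nontrivial_iff_ne_bot, Ne, LinearMap.range_eq_bot]
    exact fun e => hε.ne_zero (Subtype.ext (MulOpposite.unop_injective e))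
  have hE : IsGradedCSA (repGrading (QuotientAddGroup.mk' Z) ℛ V) :=
    ⟨(isRepGrading_repGrading hℛ h hmem lsmul_surjective hann).gradedAlgebra, inferInstance,
      inferInstance, isSimpleRing_end V⟩
  have h1 := ((IsGradedEquiv.refl (𝒜 := cornerGrading
    (induced (QuotientAddGroup.mk' Z) (centGrading R 𝒲)) he)).congr ha.symm)
  have h2 := ((IsGradedEquiv.refl (𝒜 := repGrading (QuotientAddGroup.mk' Z) ℛ V)).congr hb)
  have h3 := (h1.trans isGradedEquiv_leftComm).trans h2
  exact BrauerEq.of_equiv hCSA hE (isGrading_rangeGrading h hmem) hCSA.gradedAlgebra.grading h3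

theorem isBrauerInvariant_repGrading (hℛ : IsGradedAlgebra ℛ) (h : IsGradedModule ℛ 𝒲)
    (hs : IsGradedSimple R 𝒲) (hchar : ¬ ringChar F ∣ Module.finrank F (Centralizer R W))
    {Z : AddSubgroup G} (hZ : Z = (isGradedDivision_centGrading hℛ.grading h hs).centerSupp)
    {ρ : Subalgebra.center F (Centralizer R W) →ₐ[F] F} (hε : IsCharIdempotent ρ ε)
    (V : Submodule R W) [IsSimpleModule R V]
    (hann : ∀ r : R, (∀ v : V, r • v = 0) ↔ ∀ w, r • (ε : Centralizer R W).unop w = 0) :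
    IsBrauerInvariant R 𝒲 Z (repGrading (QuotientAddGroup.mk' Z) ℛ V) := by
  have hDf : FiniteDimensional F (Centralizer R W) := finiteDimensional_centralizer
  have hD := isGradedDivision_centGrading hℛ.grading h hs
  refine ⟨hD.exists_isPrimitiveIdempotent hchar, fun ε' hε' => ?_⟩
  obtain ⟨ρ', hρ'⟩ := hD.exists_isCharIdempotent_of_isPrimitiveIdempotent hchar hε'
  have hB := brauerEq_corner hℛ h hs hchar hZ hε hε.coe_idem V hann
  subst hZ
  obtain ⟨θ, hθ⟩ := hD.exists_corner_equiv hchar hρ' hε hε'.coe_idem hε.coe_idem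
  exact hB.congr_left (hD.isGradedCSA_corner hchar hρ' _) hθ

end BrauerInvariant

end GrMod

theorem mainTheorem8 {F : Type*} [Field F] [IsAlgClosed F] {G : Type*} [AddCommGroup G]
    {R : Type*} [Ring R] [Algebra F R] (ℛ : G → Submodule F R) (hℛ : GrMod.IsGradedAlgebra ℛ)
    {W : Type*} [AddCommGroup W] [Module F W] [Module R W] [IsScalarTower F R W]
    [FiniteDimensional F W] (𝒲 : G → Submodule F W) (h𝒲 : GrMod.IsGradedModule ℛ 𝒲)
    (hsimple : GrMod.IsGradedSimple R 𝒲)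
    (hchar : ¬ ringChar F ∣ Module.finrank F (GrMod.Centralizer R W))
    (V : Submodule R W) (hV : IsSimpleModule R V) :
    (∃ Z : AddSubgroup G, (Z : Set G) = GrMod.centerSupport R 𝒲 ∧
      ∃ ℰ : G ⧸ Z → Submodule F (Module.End F V),
        GrMod.IsRepGrading ℛ Z ℰ ∧
        (∀ ℰ' : G ⧸ Z → Submodule F (Module.End F V), GrMod.IsRepGrading ℛ Z ℰ' → ℰ' = ℰ) ∧
        GrMod.IsBrauerInvariant R 𝒲 Z ℰ) ∧
    (∀ H : AddSubgroup G,
      Maximal (fun K : AddSubgroup G =>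
        (K : Set G) ⊆ GrMod.support (GrMod.centGrading R 𝒲) ∧
        ∀ a ∈ GrMod.centPart R 𝒲 K, ∀ b ∈ GrMod.centPart R 𝒲 K, a * b = b * a) H →
      ∃ 𝒱 : G ⧸ H → Submodule F V,
        GrMod.IsCentralImage ℛ 𝒲 H (GrMod.centPart R 𝒲 H) 𝒱) := by
  have hDf : FiniteDimensional F (GrMod.Centralizer R W) := GrMod.finiteDimensional_centralizer
  have hD := GrMod.isGradedDivision_centGrading hℛ.grading h𝒲 hsimple
  constructor
  -- Here `ρ` is the character by which the center acts on an embedded copy of `V`, which therefore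
  -- lies in `W ε`.
  · obtain ⟨ρ, f, hfinj, hf⟩ := GrMod.exists_eigenembedding (F := F)
      (𝓕 := Subalgebra.center F (GrMod.Centralizer R W)) mul_comm V
    obtain ⟨ε, hε⟩ := hD.exists_center_isCharIdempotent hchar ρ
    have hVn : Nontrivial V := IsSimpleModule.nontrivial R V
    have hVf : FiniteDimensional F V :=
      FiniteDimensional.of_injective (V.subtype.restrictScalars F) Subtype.val_injective
    have hann := GrMod.smul_eq_zero_iff hℛ.grading h𝒲 hsimple hchar hε hfinj hf
    have hmem : (ε : GrMod.Centralizer R W) ∈ ⨆ k : hD.centerSupp, GrMod.centGrading R 𝒲 k :=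
      hD.toSubmodule_center ▸ ε.2
    exact ⟨hD.centerSupp, rfl, _,
      GrMod.isRepGrading_repGrading hℛ h𝒲 hmem GrMod.lsmul_surjective hann,
      fun ℰ' hℰ' => hℰ'.eq_repGrading hℛ.grading GrMod.lsmul_surjective,
      GrMod.isBrauerInvariant_repGrading hℛ h𝒲 hsimple hchar rfl hε V hann⟩
  · exact fun H hH => GrMod.exists_isCentralImage hℛ.grading h𝒲 hsimple hchar V hH rfl
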